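/- Let $d\ge 2$ and let $\Omega\subset\mathbb{R}^d$ be a bounded, simply connected Lipschitz domain. Write $\|\cdot\|_\omega$ for the norms of $L_2(\omega)$ and $\boldsymbol{L}_2(\omega)=L_2(\omega)^d$ (with $\|\cdot\|=\|\cdot\|_\Omega$), let $\mathrm{div}$ and $\nabla$ be taken in the sense of distributions, and set \[ H(\mathrm{div},\Omega)=\{\boldsymbol{v}\in\boldsymbol{L}_2(\Omega):\ \mathrm{div}\,\boldsymbol{v}\in L_2(\Omega)\},\qquad H_0(\mathrm{div},\Omega)=\{\boldsymbol{v}\in H(\mathrm{div},\Omega):\ (\boldsymbol{v}\cdot\boldsymbol{n})|_{\partial\Omega}=0\}, \] where $(\boldsymbol{v}\cdot\boldsymbol{n})|_{\partial\Omega}$ denotes the functional $z\mapsto \int_\Omega (z\,\mathrm{div}\,\boldsymbol{v}+\nabla z\cdot\boldsymbol{v})\,dx$ on $H^1(\Omega)$. Let \[ \mathfrak{V}_0(\Omega)=H_0(\mathrm{div},\Omega)\times H^1_0(\Omega)\times H(\mathrm{div},\Omega)\times H^1(\Omega). \] There is a constant $C>0$, depending only on $\Omega$, such that for all data $\boldsymbol{g}_1,\boldsymbol{g}_3\in\boldsymbol{L}_2(\Omega)$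 and $g_2,g_4\in L_2(\Omega)$ the following holds. There is a unique $\mathfrak{v}=(\boldsymbol{v}_1,v_2,\boldsymbol{v}_3,v_4)\in\mathfrak{V}_0(\Omega)$ with \[ \boldsymbol{v}_1-\nabla v_4=\boldsymbol{g}_1,\qquad v_4+\mathrm{div}\,\boldsymbol{v}_3=g_2,\qquad \boldsymbol{v}_3+\nabla v_2=\boldsymbol{g}_3,\qquad v_2+\mathrm{div}\,\boldsymbol{v}_1=g_4 \quad\text{in }\Omega, \] and for every mesh $\mathcal{T}$ of $\Omega$, that is, every finite family of pairwise disjoint bounded Lipschitz domains $T\subset\Omega$ with $\overline\Omega=\bigcup_{T\in\mathcal{T}}\overline T$ (in particular for $\mathcal{T}=\{\Omega\}$), it satisfies \[ \|\mathfrak{v}\|_{\mathfrak{V}(\mathcal{T})}^2\le C\left(\|\boldsymbol{g}_1\|^2+\|g_2\|^2+\|\boldsymbol{g}_3\|^2+\|g_4\|^2\right), \] where \[ \|\mathfrak{v}\|_{\mathfrak{V}(\mathcal{T})}^2=\sum_{T\in\mathcal{T}}\left(\|\boldsymbol{v}_1\|_T^2+\|\mathrm{div}\,\boldsymbol{v}_1\|_T^2+\|v_2\|_T^2+\|\nabla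 v_2\|_T^2+\|\boldsymbol{v}_3\|_T^2+\|\mathrm{div}\,\boldsymbol{v}_3\|_T^2+\|v_4\|_T^2+\|\nabla v_4\|_T^2\right). \] -/

import Mathlib

open MeasureTheory TopologicalSpace
open scoped Distributions

noncomputable section

namespace FourthOrderDiv

/-- The Euclidean space `ℝ^d`. -/
abbrev Space (d : ℕ) : Type := EuclideanSpace ℝ (Fin d)

variable {d : ℕ}

/-- `Ω` is a bounded Lipschitz domain: a bounded, connected, nonempty open set that, near each of
its boundary points, lies strictly above the graph of a Lipschitz function `γ` in the direction of
a unit vector `e`. The point `y - ⟪e, y⟫ e` is the orthogonal projection of `y` onto the hyperplane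
`e^⊥` and `⟪e, y⟫` is the height of `y` over it; only the values of `γ` on `e^⊥` matter. -/
structure IsLipschitzDomain (Ω : Opens (Space d)) : Prop where
  bounded : Bornology.IsBounded (Ω : Set (Space d))
  connected : IsConnected (Ω : Set (Space d))
  boundary : ∀ x ∈ frontier (Ω : Set (Space d)),
    ∃ (r : ℝ) (e : Space d) (K : NNReal) (γ : Space d → ℝ),
      0 < r ∧ ‖e‖ = 1 ∧ LipschitzWith K γ ∧
        ∀ y ∈ Metric.ball x r, y ∈ Ω ↔ γ (y - inner ℝ e y • e) < inner ℝ e y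

/-- `L₂(Ω)`. -/
abbrev ScalarL2 (Ω : Opens (Space d)) : Type :=
  Lp ℝ 2 (volume.restrict (Ω : Set (Space d)))

/-- `𝐋₂(Ω) = L₂(Ω)^d`. -/
abbrev VectorL2 (Ω : Opens (Space d)) : Type :=
  Lp (Space d) 2 (volume.restrict (Ω : Set (Space d)))

/-- `G = ∇u` in `Ω` in the sense of distributions. -/
def IsWeakGrad (Ω : Opens (Space d)) (u : ScalarL2 Ω) (G : VectorL2 Ω) : Prop :=
  ∀ φ : 𝓓(Ω, ℝ), ∫ x in (Ω : Set (Space d)), u x • gradient (φ : Space d → ℝ) x =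
    -∫ x in (Ω : Set (Space d)), φ x • G x

/-- `w = div v` in `Ω` in the sense of distributions. -/
def IsWeakDiv (Ω : Opens (Space d)) (v : VectorL2 Ω) (w : ScalarL2 Ω) : Prop :=
  ∀ φ : 𝓓(Ω, ℝ),
    ∫ x in (Ω : Set (Space d)), inner ℝ (v x) (gradient (φ : Space d → ℝ) x) =
      -∫ x in (Ω : Set (Space d)), φ x • w x

theorem Lp_eq_of_test {F : Type*} [NormedAddCommGroup F] [InnerProductSpace ℝ F] [CompleteSpace F]
    {Ω : Opens (Space d)} {f g : Lp F 2 (volume.restrict (Ω : Set (Space d)))}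
    (h : ∀ φ : 𝓓(Ω, ℝ), ∫ x in (Ω : Set (Space d)), φ x • f x =
      ∫ x in (Ω : Set (Space d)), φ x • g x) : f = g := by
  have hloc : ∀ k : Lp F 2 (volume.restrict (Ω : Set (Space d))),
      LocallyIntegrable k (volume.restrict (Ω : Set (Space d))) := fun k =>
    (Lp.memLp k).locallyIntegrable (by norm_num)
  have key := IsOpen.ae_eq_zero_of_integral_contDiff_smul_eq_zero (μ := volume.restrict
    (Ω : Set (Space d))) Ω.isOpen (f := fun x => f x - g x)
    (((hloc f).sub (hloc g)).locallyIntegrableOn _) (by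
      intro φ h1 h2 h3
      have := h ⟨φ, h1, h2, h3⟩
      have e1 : Integrable (fun x => φ x • f x) (volume.restrict (Ω : Set (Space d))) :=
        (hloc f).integrable_smul_left_of_hasCompactSupport h1.continuous h2
      have e2 : Integrable (fun x => φ x • g x) (volume.restrict (Ω : Set (Space d))) :=
        (hloc g).integrable_smul_left_of_hasCompactSupport h1.continuous h2
      simp only [smul_sub]
      rw [integral_sub e1 e2]
      exact sub_eq_zero.2 this)
  apply Lp.ext
  filter_upwards [key, ae_restrict_mem Ω.isOpen.measurableSet] with x hx hm
  exact sub_eq_zero.1 (hx hm)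

/-- Weak gradients are unique, so `weakGrad` below is well defined. -/
theorem IsWeakGrad.unique {Ω : Opens (Space d)} {u : ScalarL2 Ω} {G H : VectorL2 Ω}
    (hG : IsWeakGrad Ω u G) (hH : IsWeakGrad Ω u H) : G = H :=
  Lp_eq_of_test fun φ => neg_injective ((hG φ).symm.trans (hH φ))

/-- Weak divergences are unique, so `weakDiv` below is well defined. -/
theorem IsWeakDiv.unique {Ω : Opens (Space d)} {v : VectorL2 Ω} {w z : ScalarL2 Ω}
    (hw : IsWeakDiv Ω v w) (hz : IsWeakDiv Ω v z) : w = z :=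
  Lp_eq_of_test fun φ => neg_injective ((hw φ).symm.trans (hz φ))

/-- The Sobolev space `H¹(Ω)`. -/
def H1 (Ω : Opens (Space d)) : Set (ScalarL2 Ω) := {u | ∃ G, IsWeakGrad Ω u G}

/-- The space `H(div, Ω)`. -/
def Hdiv (Ω : Opens (Space d)) : Set (VectorL2 Ω) := {v | ∃ w, IsWeakDiv Ω v w}

open Classical in
/-- The gradient `∇u` of `u ∈ H¹(Ω)` (zero outside of `H¹(Ω)`). -/
def weakGrad (Ω : Opens (Space d)) (u : ScalarL2 Ω) : VectorL2 Ω :=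
  if h : ∃ G, IsWeakGrad Ω u G then h.choose else 0

open Classical in
/-- The divergence `div v` of `v ∈ H(div, Ω)` (zero outside of `H(div, Ω)`). -/
def weakDiv (Ω : Opens (Space d)) (v : VectorL2 Ω) : ScalarL2 Ω :=
  if h : ∃ w, IsWeakDiv Ω v w then h.choose else 0

/-- The pairs `(φ, ∇φ)` with `φ ∈ C_c^∞(Ω)`, as elements of `L₂(Ω) × 𝐋₂(Ω)`. -/
def testPairs (Ω : Opens (Space d)) : Set (ScalarL2 Ω × VectorL2 Ω) :=
  {p | ∃ φ : 𝓓(Ω, ℝ), p.1 =ᵐ[volume.restrict (Ω : Set (Space d))] (φ : Space d → ℝ) ∧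
    p.2 =ᵐ[volume.restrict (Ω : Set (Space d))] gradient (φ : Space d → ℝ)}

/-- The space `H¹₀(Ω)`, the closure of `C_c^∞(Ω)` in `H¹(Ω)`. -/
def H10 (Ω : Opens (Space d)) : Set (ScalarL2 Ω) :=
  {u | u ∈ H1 Ω ∧ (u, weakGrad Ω u) ∈ closure (testPairs Ω)}

/-- The space `H₀(div, Ω)` of all `v ∈ H(div, Ω)` with vanishing normal trace on the boundary,
the normal trace being the functional `z ↦ (z, div v) + (∇z, v)` on `H¹(Ω)`. -/
def Hdiv0 (Ω : Opens (Space d)) : Set (VectorL2 Ω) :=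
  {v | v ∈ Hdiv Ω ∧ ∀ z ∈ H1 Ω, inner ℝ z (weakDiv Ω v) + inner ℝ (weakGrad Ω z) v = 0}

/-- Quadruples `(v₁, v₂, v₃, v₄)` in `𝐋₂(Ω) × L₂(Ω) × 𝐋₂(Ω) × L₂(Ω)`. -/
@[ext]
structure Quad (Ω : Opens (Space d)) where
  v₁ : VectorL2 Ω
  v₂ : ScalarL2 Ω
  v₃ : VectorL2 Ω
  v₄ : ScalarL2 Ω

/-- The space `𝔙₀(Ω) = H₀(div, Ω) × H¹₀(Ω) × H(div, Ω) × H¹(Ω)`. -/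
def V0 (Ω : Opens (Space d)) : Set (Quad Ω) :=
  {v | v.v₁ ∈ Hdiv0 Ω ∧ v.v₂ ∈ H10 Ω ∧ v.v₃ ∈ Hdiv Ω ∧ v.v₄ ∈ H1 Ω}

/-- The adjoint first-order system with data `g₁, g₂, g₃, g₄`. -/
def SolvesAdjoint {Ω : Opens (Space d)} (g₁ : VectorL2 Ω) (g₂ : ScalarL2 Ω) (g₃ : VectorL2 Ω)
    (g₄ : ScalarL2 Ω) (v : Quad Ω) : Prop :=
  v.v₁ - weakGrad Ω v.v₄ = g₁ ∧
  v.v₄ + weakDiv Ω v.v₃ = g₂ ∧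
  v.v₃ + weakGrad Ω v.v₂ = g₃ ∧
  v.v₂ + weakDiv Ω v.v₁ = g₄

/-- A mesh of `Ω`: finitely many pairwise disjoint Lipschitz elements contained in `Ω` whose
closures cover the closure of `Ω`. -/
structure Mesh (Ω : Opens (Space d)) where
  n : ℕ
  elem : Fin n → Opens (Space d)
  lipschitz : ∀ i, IsLipschitzDomain (elem i)
  subset : ∀ i, elem i ≤ Ω
  disjoint : Pairwise fun i j => Disjoint (elem i : Set (Space d)) (elem j : Set (Space d))
  cover : closure (Ω : Set (Space d)) = ⋃ i, closure (elem i : Set (Space d))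

/-- The restriction to `ω ⊆ Ω` of an `L₂` function on `Ω`. -/
def restrictL2 {F : Type*} [NormedAddCommGroup F] {ω Ω : Opens (Space d)} (h : ω ≤ Ω)
    (u : Lp F 2 (volume.restrict (Ω : Set (Space d)))) :
    Lp F 2 (volume.restrict (ω : Set (Space d))) :=
  ((Lp.memLp u).mono_measure (Measure.restrict_mono h le_rfl)).toLp u

/-- `‖v‖²_{div, ω} = ‖v‖²_ω + ‖div v‖²_ω`. -/
def hdivNormSq (ω : Opens (Space d)) (v : VectorL2 ω) : ℝ := ‖v‖ ^ 2 + ‖weakDiv ω v‖ ^ 2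

/-- `‖u‖²_{1, ω} = ‖u‖²_ω + ‖∇u‖²_ω`. -/
def h1NormSq (ω : Opens (Space d)) (u : ScalarL2 ω) : ℝ := ‖u‖ ^ 2 + ‖weakGrad ω u‖ ^ 2

/-- The squared product norm
`‖v₁‖²_{div, 𝒯} + ‖v₂‖²_{1, 𝒯} + ‖v₃‖²_{div, 𝒯} + ‖v₄‖²_{1, 𝒯}` on `𝔙(𝒯)`. -/
def brokenNormSq {Ω : Opens (Space d)} (𝒯 : Mesh Ω) (v : Quad Ω) : ℝ :=
  ∑ i : Fin 𝒯.n,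
    (hdivNormSq (𝒯.elem i) (restrictL2 (𝒯.subset i) v.v₁) +
      h1NormSq (𝒯.elem i) (restrictL2 (𝒯.subset i) v.v₂) +
      hdivNormSq (𝒯.elem i) (restrictL2 (𝒯.subset i) v.v₃) +
      h1NormSq (𝒯.elem i) (restrictL2 (𝒯.subset i) v.v₄))

end FourthOrderDiv

end

open Metric

noncomputable section

namespace FourthOrderDiv

variable {d : ℕ} {Ω : Opens (Space d)}

/-! Eliminating `v₁ = g₁ + ∇v₄` and `v₃ = g₃ - ∇v₂` leaves a mixed problem for `p = v₂ ∈ H¹₀` and `q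
= v₄ ∈ H¹`: testing the two divergence equations gives `(q, w) + (∇p, ∇w) = (g₂, w) + (g₃, ∇w)` on
`H¹₀` and `(∇q, ∇z) - (p, z) = -(g₄, z) - (g₁, ∇z)` on `H¹`. The vanishing normal trace of `v₁` is
the natural boundary condition of the second equation.

Friedrichs' inequality makes the Dirichlet solution operator `R` available, so `p` can be eliminated
too. The remaining form in `q` has energy `‖∇Rq‖² + ‖∇q‖²`, where `‖∇Rq‖` is the norm of `q` as a
functional on `H¹₀`. It is coercive by the key estimate `‖u‖ ≤ C (‖∇u‖ + ‖u‖_{H⁻¹})`,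
`IsLipschitzDomain.exists_norm_le`. Testing with `w = p`, `z = q` cancels the coupling and gives the
a priori bound, hence also uniqueness.

The key estimate is proved without compactness. Near each point of the closure, the Lipschitz
condition allows translation into the domain by a whole ball of vectors `h`. Averaging the
translates of a local test function `φ` with a bump `ψ` changes its pairing with `u` by at most `C
‖∇u‖ ‖φ‖`, while the averaged pairing superposes pairings with fixed-shape test functions `ψ(· -
y)`, controlled by the `H⁻¹` norm. Finitely many balls suffice.

Weak derivatives restrict to subdomains and the elements are disjoint, so the mesh norm is at most
the norm on `Ω`; the constant is therefore independent of the mesh. -/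

/-! ### Test functions as `L₂` elements, and weak derivatives as `L₂` pairings. -/

theorem continuous_gradient {f : Space d → ℝ} (hf : ContDiff ℝ 1 f) : Continuous (gradient f) :=
  (InnerProductSpace.toDual ℝ (Space d)).symm.continuous.comp (hf.continuous_fderiv (by simp))

theorem hasCompactSupport_gradient {f : Space d → ℝ} (hf : HasCompactSupport f) :
    HasCompactSupport (gradient f) :=
  (hf.fderiv (𝕜 := ℝ)).comp_left (map_zero (InnerProductSpace.toDual ℝ (Space d)).symm)

theorem contDiff_one_test (φ : 𝓓(Ω, ℝ)) : ContDiff ℝ 1 φ :=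
  φ.contDiff.of_le (by exact_mod_cast le_top)

theorem memLp_test (μ : Measure (Space d)) [IsFiniteMeasureOnCompacts μ] (φ : 𝓓(Ω, ℝ)) :
    MemLp φ 2 μ :=
  φ.continuous.memLp_of_hasCompactSupport φ.hasCompactSupport

theorem memLp_gradient_test (μ : Measure (Space d)) [IsFiniteMeasureOnCompacts μ] (φ : 𝓓(Ω, ℝ)) :
    MemLp (gradient (φ : Space d → ℝ)) 2 μ :=
  (continuous_gradient (contDiff_one_test φ)).memLp_of_hasCompactSupport
    (hasCompactSupport_gradient φ.hasCompactSupport)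

theorem memLp_test_smul (μ : Measure (Space d)) [IsFiniteMeasureOnCompacts μ] (φ : 𝓓(Ω, ℝ))
    (c : Space d) : MemLp (fun x => φ x • c) 2 μ :=
  (φ.continuous.smul continuous_const).memLp_of_hasCompactSupport
    (φ.hasCompactSupport.smul_right)

/-- A test function as an element of `L₂(Ω)`. -/
def testL2 (φ : 𝓓(Ω, ℝ)) : ScalarL2 Ω := (memLp_test _ φ).toLp

/-- The gradient of a test function as an element of `𝐋₂(Ω)`. -/
def gradL2 (φ : 𝓓(Ω, ℝ)) : VectorL2 Ω := (memLp_gradient_test _ φ).toLp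

/-- The vector field `φ c` as an element of `𝐋₂(Ω)`. -/
def testVecL2 (φ : 𝓓(Ω, ℝ)) (c : Space d) : VectorL2 Ω := (memLp_test_smul _ φ c).toLp

theorem inner_toLp_left {F : Type*} [NormedAddCommGroup F] [InnerProductSpace ℝ F]
    {μ : Measure (Space d)} {f : Space d → F} (hf : MemLp f 2 μ) (g : Lp F 2 μ) :
    inner ℝ (hf.toLp f) g = ∫ x, inner ℝ (f x) (g x) ∂μ := by
  rw [L2.inner_def]
  refine integral_congr_ae ?_
  filter_upwards [hf.coeFn_toLp] with x hx
  rw [hx]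

theorem norm_sq_eq_integral {F : Type*} [NormedAddCommGroup F] [InnerProductSpace ℝ F]
    {μ : Measure (Space d)} (g : Lp F 2 μ) : ‖g‖ ^ 2 = ∫ x, ‖g x‖ ^ 2 ∂μ := by
  rw [← real_inner_self_eq_norm_sq, L2.inner_def]
  simp only [real_inner_self_eq_norm_sq]

theorem norm_toLp_sq {F : Type*} [NormedAddCommGroup F] [InnerProductSpace ℝ F]
    {μ : Measure (Space d)} {f : Space d → F} (hf : MemLp f 2 μ) :
    ‖hf.toLp f‖ ^ 2 = ∫ x, ‖f x‖ ^ 2 ∂μ := by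
  rw [norm_sq_eq_integral]
  refine integral_congr_ae ?_
  filter_upwards [hf.coeFn_toLp] with x hx
  rw [hx]

theorem inner_testL2 (φ : 𝓓(Ω, ℝ)) (u : ScalarL2 Ω) :
    inner ℝ (testL2 φ) u = ∫ x in (Ω : Set (Space d)), φ x * u x := by
  rw [testL2, inner_toLp_left]
  simp [mul_comm]

theorem inner_gradL2 (φ : 𝓓(Ω, ℝ)) (v : VectorL2 Ω) :
    inner ℝ (gradL2 φ) v =
      ∫ x in (Ω : Set (Space d)), inner ℝ (v x) (gradient (φ : Space d → ℝ) x) := by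
  rw [gradL2, inner_toLp_left]
  simp only [real_inner_comm]

theorem inner_testVecL2 (φ : 𝓓(Ω, ℝ)) (c : Space d) (v : VectorL2 Ω) :
    inner ℝ (testVecL2 φ c) v = ∫ x in (Ω : Set (Space d)), φ x * inner ℝ c (v x) := by
  rw [testVecL2, inner_toLp_left]
  simp only [real_inner_smul_left]

theorem norm_testVecL2_le (φ : 𝓓(Ω, ℝ)) (c : Space d) :
    ‖testVecL2 φ c‖ ≤ ‖c‖ * ‖testL2 φ‖ := by
  refine Lp.norm_le_mul_norm_of_ae_le_mul ?_
  filter_upwards [(memLp_test_smul (volume.restrict (Ω : Set (Space d))) φ c).coeFn_toLp,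
    (memLp_test (volume.restrict (Ω : Set (Space d))) φ).coeFn_toLp] with x h1 h2
  rw [testVecL2, testL2, h1, h2, norm_smul, mul_comm]

theorem integrable_of_L2_mul_gradient {F : Type*} [NormedAddCommGroup F] [NormedSpace ℝ F]
    (u : ScalarL2 Ω) {f : Space d → F} (hf : Continuous f) (hc : HasCompactSupport f) :
    Integrable (fun x => u x • f x) (volume.restrict (Ω : Set (Space d))) :=
  ((Lp.memLp u).locallyIntegrable (by norm_num)).integrable_smul_right_of_hasCompactSupport hf hc

/-- Pairing the vector identity with each fixed `c` makes it scalar, so that it can be used along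
one translation direction and seen to be closed in `L₂`. -/
theorem isWeakGrad_iff {u : ScalarL2 Ω} {G : VectorL2 Ω} :
    IsWeakGrad Ω u G ↔ ∀ (φ : 𝓓(Ω, ℝ)) (c : Space d),
      ∫ x in (Ω : Set (Space d)), u x * fderiv ℝ φ x c = -inner ℝ (testVecL2 φ c) G := by
  have hG : ∀ φ : 𝓓(Ω, ℝ), Integrable (fun x => φ x • G x)
      (volume.restrict (Ω : Set (Space d))) := fun φ =>
    ((Lp.memLp G).locallyIntegrable (by norm_num)).integrable_smul_left_of_hasCompactSupport
      φ.continuous φ.hasCompactSupport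
  have hu : ∀ φ : 𝓓(Ω, ℝ), Integrable (fun x => u x • gradient (φ : Space d → ℝ) x)
      (volume.restrict (Ω : Set (Space d))) := fun φ =>
    integrable_of_L2_mul_gradient u (continuous_gradient (contDiff_one_test φ))
      (hasCompactSupport_gradient φ.hasCompactSupport)
  have e1 : ∀ (φ : 𝓓(Ω, ℝ)) (c : Space d),
      ∫ x in (Ω : Set (Space d)), u x * fderiv ℝ φ x c =
        inner ℝ c (∫ x in (Ω : Set (Space d)), u x • gradient (φ : Space d → ℝ) x) := by
    intro φ c
    rw [← integral_inner (hu φ)]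
    refine integral_congr_ae (.of_forall fun x => ?_)
    simp only [real_inner_smul_right, ← inner_gradient_left, real_inner_comm c]
  have e2 : ∀ (φ : 𝓓(Ω, ℝ)) (c : Space d),
      inner ℝ (testVecL2 φ c) G = inner ℝ c (∫ x in (Ω : Set (Space d)), φ x • G x) := by
    intro φ c
    rw [← integral_inner (hG φ), inner_testVecL2]
    simp only [real_inner_smul_right]
  constructor
  · intro h φ c
    rw [e1, e2, h φ, inner_neg_right]
  · intro h φ
    refine ext_inner_left ℝ fun c => ?_
    rw [inner_neg_right, ← e1, ← e2, h]

theorem isWeakDiv_iff {v : VectorL2 Ω} {w : ScalarL2 Ω} :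
    IsWeakDiv Ω v w ↔ ∀ φ : 𝓓(Ω, ℝ), inner ℝ (testL2 φ) w + inner ℝ (gradL2 φ) v = 0 := by
  refine forall_congr' fun φ => ?_
  rw [inner_testL2, inner_gradL2, add_comm, ← eq_neg_iff_add_eq_zero]
  rfl

theorem mem_testPairs_iff {p : ScalarL2 Ω × VectorL2 Ω} :
    p ∈ testPairs Ω ↔ ∃ φ : 𝓓(Ω, ℝ), p = (testL2 φ, gradL2 φ) := by
  refine exists_congr fun φ => ?_
  constructor
  · rintro ⟨h1, h2⟩
    refine Prod.ext (Lp.ext (h1.trans ?_)) (Lp.ext (h2.trans ?_))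
    · exact (memLp_test _ φ).coeFn_toLp.symm
    · exact (memLp_gradient_test _ φ).coeFn_toLp.symm
  · rintro rfl
    exact ⟨(memLp_test _ φ).coeFn_toLp, (memLp_gradient_test _ φ).coeFn_toLp⟩

/-- If all `L₂` pairings of `f` with test functions are bounded by `A`, then `‖f‖ ≤ A`. -/
theorem norm_le_of_test_le (f : ScalarL2 Ω) {A : ℝ} (hA : 0 ≤ A)
    (h : ∀ φ : 𝓓(Ω, ℝ), |inner ℝ (testL2 φ) f| ≤ A * ‖testL2 φ‖) : ‖f‖ ≤ A := by
  let S : Submodule ℝ (ScalarL2 Ω) := Submodule.span ℝ (Set.range testL2)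
  have hS : ∀ g ∈ S, ∃ φ : 𝓓(Ω, ℝ), g = testL2 φ := by
    intro g hg
    induction hg using Submodule.span_induction with
    | mem x hx => obtain ⟨φ, rfl⟩ := hx; exact ⟨φ, rfl⟩
    | zero => exact ⟨0, by rw [testL2]; symm; exact MemLp.toLp_zero _⟩
    | add x y _ _ hx hy =>
      obtain ⟨φ, rfl⟩ := hx
      obtain ⟨ψ, rfl⟩ := hy
      exact ⟨φ + ψ, (MemLp.toLp_add _ _).symm⟩
    | smul a x _ hx =>
      obtain ⟨φ, rfl⟩ := hx
      exact ⟨a • φ, (MemLp.toLp_const_smul _ _).symm⟩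
  -- Test functions are dense: by the fundamental lemma nothing nonzero is orthogonal to them. The
  -- bound then passes to `g = f`, where it reads `‖f‖² ≤ A ‖f‖`.
  have hbot : Sᗮ = ⊥ := by
    rw [Submodule.eq_bot_iff]
    intro g hg
    refine Lp_eq_of_test fun φ => ?_
    have := (Submodule.mem_orthogonal _ _).1 hg (testL2 φ) (Submodule.subset_span ⟨φ, rfl⟩)
    rw [inner_testL2] at this
    simp only [smul_eq_mul]
    rw [this]
    symm
    refine integral_eq_zero_of_ae ?_
    filter_upwards [Lp.coeFn_zero ℝ 2 (volume.restrict (Ω : Set (Space d)))] with x hx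
    simp only [hx, Pi.zero_apply, mul_zero]
  have htop : closure (S : Set (ScalarL2 Ω)) = Set.univ := by
    have := (Submodule.topologicalClosure_eq_top_iff).2 hbot
    rw [← Submodule.topologicalClosure_coe, this]
    rfl
  have hcl : IsClosed {g : ScalarL2 Ω | |inner ℝ g f| ≤ A * ‖g‖} :=
    isClosed_le (by fun_prop) (by fun_prop)
  have hf : f ∈ {g : ScalarL2 Ω | |inner ℝ g f| ≤ A * ‖g‖} := by
    refine closure_minimal ?_ hcl (htop ▸ Set.mem_univ f)
    intro g hg
    obtain ⟨φ, rfl⟩ := hS g hg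
    exact h φ
  by_cases h0 : f = 0
  · simpa [h0] using hA
  · have hp := norm_pos_iff.2 h0
    have : |inner ℝ f f| ≤ A * ‖f‖ := hf
    rw [real_inner_self_eq_norm_sq, abs_of_nonneg (by positivity), sq] at this
    exact le_of_mul_le_mul_right this hp

/-! ### Translations inside a Lipschitz domain. -/

/-- Near every point of its closure, a Lipschitz domain admits translations along the segments
given by all vectors of some ball. -/
theorem IsLipschitzDomain.exists_segment_subset (hΩ : IsLipschitzDomain Ω) {x₀ : Space d}
    (hx₀ : x₀ ∈ closure (Ω : Set (Space d))) :
    ∃ (ρ δ : ℝ) (h₀ : Space d), 0 < ρ ∧ 0 < δ ∧ ∀ y ∈ ball x₀ ρ, y ∈ Ω →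
      ∀ h ∈ closedBall h₀ δ, ∀ s ∈ Set.Icc (0 : ℝ) 1, y + s • h ∈ Ω := by
  by_cases hin : x₀ ∈ Ω
  · obtain ⟨r, hr, hsub⟩ := Metric.isOpen_iff.1 Ω.isOpen x₀ hin
    refine ⟨r / 2, r / 2, 0, by positivity, by positivity, fun y hy _ h hh s hs => hsub ?_⟩
    rw [mem_ball, dist_eq_norm] at hy ⊢
    rw [mem_closedBall_zero_iff] at hh
    have e : y + s • h - x₀ = (y - x₀) + s • h := by abel
    have : ‖s • h‖ ≤ r / 2 := by
      rw [norm_smul, Real.norm_of_nonneg hs.1]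
      nlinarith [norm_nonneg h, hs.2, hs.1]
    rw [e]
    linarith [norm_add_le (y - x₀) (s • h)]
  · have hfr : x₀ ∈ frontier (Ω : Set (Space d)) := by
      rw [frontier, Ω.isOpen.interior_eq]
      exact ⟨hx₀, hin⟩
    obtain ⟨r, e, K, γ, hr, he, hγ, hgr⟩ := hΩ.boundary x₀ hfr
    -- For `h = (r/4) e + k` with `‖k‖ ≤ δ`, moving by `s h` raises the height by at least `s (r/4 -
    -- δ) = s (2K + 1) δ`, while the graph rises by at most `2 K δ s`. The point also stays within
    -- `r/4 + r/2 < r` of `x₀`.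
    set δ : ℝ := r / 4 / (2 * K + 2) with hδ
    have hK : (0 : ℝ) ≤ K := K.2
    have hδ0 : 0 < δ := by positivity
    have hδm : δ * (2 * K + 2) = r / 4 := by rw [hδ]; field_simp
    refine ⟨r / 4, δ, (r / 4) • e, by positivity, hδ0, fun y hy hyΩ h hh s hs => ?_⟩
    rw [mem_ball, dist_eq_norm] at hy
    rw [mem_closedBall, dist_eq_norm] at hh
    set k := h - (r / 4) • e with hk
    have hh' : h = k + (r / 4) • e := by rw [hk]; abel
    have hee : inner ℝ e e = (1 : ℝ) := by rw [real_inner_self_eq_norm_sq, he]; norm_num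
    have hke : |inner ℝ e k| ≤ δ := (abs_real_inner_le_norm e k).trans (by rw [he]; linarith)
    have hδr : δ ≤ r / 4 := by nlinarith
    have hyr : y ∈ ball x₀ r := by rw [mem_ball, dist_eq_norm]; linarith
    have hnh : ‖s • h‖ ≤ r / 2 := by
      have : ‖h‖ ≤ δ + r / 4 := by
        rw [hh']
        refine (norm_add_le _ _).trans ?_
        rw [norm_smul, he, Real.norm_of_nonneg (by positivity)]
        linarith
      rw [norm_smul, Real.norm_of_nonneg hs.1]
      nlinarith [norm_nonneg h, hs.2, hs.1]
    have hysr : y + s • h ∈ ball x₀ r := by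
      rw [mem_ball, dist_eq_norm]
      have e' : y + s • h - x₀ = (y - x₀) + s • h := by abel
      rw [e']
      linarith [norm_add_le (y - x₀) (s • h)]
    rw [hgr _ hysr]
    have h1 := (hgr y hyr).1 hyΩ
    have h2 := hγ.dist_le_mul (y + s • h - inner ℝ e (y + s • h) • e) (y - inner ℝ e y • e)
    have e1 : inner ℝ e (y + s • h) = inner ℝ e y + s * (inner ℝ e k + r / 4) := by
      rw [hh', inner_add_right, real_inner_smul_right, inner_add_right, real_inner_smul_right, hee]
      ring
    have e2 : y + s • h - inner ℝ e (y + s • h) • e - (y - inner ℝ e y • e) =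
        s • (k - inner ℝ e k • e) := by
      rw [e1, hh']
      module
    rw [dist_eq_norm, dist_eq_norm, e2, norm_smul, Real.norm_of_nonneg hs.1] at h2
    have h3 : ‖k - inner ℝ e k • e‖ ≤ 2 * δ := by
      refine (norm_sub_le _ _).trans ?_
      rw [norm_smul, he, Real.norm_eq_abs]
      linarith
    have h4 : γ (y + s • h - inner ℝ e (y + s • h) • e) ≤
        γ (y - inner ℝ e y • e) + K * (s * (2 * δ)) := by
      have := le_of_abs_le h2
      have h5 : K * (s * ‖k - inner ℝ e k • e‖) ≤ K * (s * (2 * δ)) :=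
        mul_le_mul_of_nonneg_left (mul_le_mul_of_nonneg_left h3 hs.1) hK
      linarith
    have h5 : s * (2 * K * δ) ≤ s * (inner ℝ e k + r / 4) := by
      refine mul_le_mul_of_nonneg_left ?_ hs.1
      have := neg_le_of_abs_le hke
      nlinarith
    rw [e1] at h4 ⊢
    nlinarith

theorem test_eq_zero (φ : 𝓓(Ω, ℝ)) {x : Space d} (hx : x ∉ Ω) : φ x = 0 :=
  image_eq_zero_of_notMem_tsupport fun h => hx (φ.tsupport_subset h)

theorem norm_testL2_sq (φ : 𝓓(Ω, ℝ)) : ‖testL2 φ‖ ^ 2 = ∫ x, φ x ^ 2 := by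
  rw [testL2, norm_toLp_sq]
  simp only [Real.norm_eq_abs, sq_abs]
  refine setIntegral_eq_integral_of_forall_compl_eq_zero fun x hx => ?_
  rw [test_eq_zero φ hx]
  norm_num

theorem gradient_eq_zero_of_notMem_tsupport {f : Space d → ℝ} {x : Space d} (hx : x ∉ tsupport f) :
    gradient f x = 0 := by
  have : fderiv ℝ f x = 0 :=
    Function.notMem_support.1 fun h => hx (support_fderiv_subset ℝ h)
  rw [gradient, this, map_zero]

theorem norm_gradL2_sq (φ : 𝓓(Ω, ℝ)) :
    ‖gradL2 φ‖ ^ 2 = ∫ x, ‖gradient (φ : Space d → ℝ) x‖ ^ 2 := by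
  rw [gradL2, norm_toLp_sq]
  refine setIntegral_eq_integral_of_forall_compl_eq_zero fun x hx => ?_
  rw [gradient_eq_zero_of_notMem_tsupport fun h => hx (φ.tsupport_subset h)]
  norm_num

/-- The smooth compactly supported function `f(· - h)` as a test function on `Ω`. -/
def translate (f : Space d → ℝ) (hf : ContDiff ℝ ((⊤ : ℕ∞) : WithTop ℕ∞) f)
    (hc : HasCompactSupport f) (h : Space d) (hs : ∀ y ∈ tsupport f, y + h ∈ Ω) : 𝓓(Ω, ℝ) where
  toFun x := f (x - h)
  contDiff' := hf.comp (contDiff_id.sub contDiff_const)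
  hasCompactSupport' := hc.comp_homeomorph (Homeomorph.subRight h)
  tsupport_subset' := by
    intro x hx
    have := tsupport_comp_subset_preimage f (continuous_id.sub (continuous_const (y := h))) hx
    have h2 := hs _ this
    simpa using h2

theorem gradient_comp_sub (f : Space d → ℝ) (h x : Space d) :
    gradient (fun x => f (x - h)) x = gradient f (x - h) := by
  rw [gradient, gradient, fderiv_comp_sub]

theorem norm_testL2_translate (φ : 𝓓(Ω, ℝ)) (h : Space d) (hs) :
    ‖testL2 (translate φ φ.contDiff φ.hasCompactSupport h hs : 𝓓(Ω, ℝ))‖ = ‖testL2 φ‖ := by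
  rw [← sq_eq_sq₀ (norm_nonneg _) (norm_nonneg _), norm_testL2_sq, norm_testL2_sq]
  exact integral_sub_right_eq_self (fun x => φ x ^ 2) h

theorem norm_gradL2_translate_sq (f : Space d → ℝ) (hf hc) (h : Space d) (hs) :
    ‖gradL2 (translate f hf hc h hs : 𝓓(Ω, ℝ))‖ ^ 2 = ∫ x, ‖gradient f x‖ ^ 2 := by
  rw [norm_gradL2_sq]
  have : ∀ x, gradient (translate f hf hc h hs : 𝓓(Ω, ℝ)) x = gradient f (x - h) :=
    gradient_comp_sub f h
  simp only [this]
  exact integral_sub_right_eq_self (fun x => ‖gradient f x‖ ^ 2) h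

theorem isFiniteMeasure_restrict (hb : Bornology.IsBounded (Ω : Set (Space d))) :
    IsFiniteMeasure (volume.restrict (Ω : Set (Space d))) :=
  ⟨by simpa using hb.measure_lt_top⟩

/-- Translating a test function changes its pairing with an `H¹` function by at most
`‖h‖ ‖∇u‖ ‖φ‖`. -/
theorem IsWeakGrad.abs_integral_translate_sub_le {u : ScalarL2 Ω} {G : VectorL2 Ω}
    (hu : IsWeakGrad Ω u G) (hb : Bornology.IsBounded (Ω : Set (Space d))) (φ : 𝓓(Ω, ℝ))
    (h : Space d) (hs : ∀ y ∈ tsupport φ, ∀ s ∈ Set.Icc (0 : ℝ) 1, y + s • h ∈ Ω) :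
    |(∫ x in (Ω : Set (Space d)), u x * φ (x - h)) - ∫ x in (Ω : Set (Space d)), u x * φ x| ≤
      ‖h‖ * ‖G‖ * ‖testL2 φ‖ := by
  have hfin := isFiniteMeasure_restrict hb
  have hui : Integrable u (volume.restrict (Ω : Set (Space d))) :=
    (Lp.memLp u).integrable (by norm_num)
  obtain ⟨A, hA⟩ := φ.continuous.bounded_above_of_compact_support φ.hasCompactSupport
  have hdφ : Continuous (fderiv ℝ φ) := (contDiff_one_test φ).continuous_fderiv (by norm_num)
  obtain ⟨B, hB⟩ := hdφ.bounded_above_of_compact_support (φ.hasCompactSupport.fderiv (𝕜 := ℝ))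
  -- The pairing with `φ(· - s h)` is differentiated in `s`; a bound on this derivative over `[0,
  -- 1]` yields the claim by the mean value inequality.
  have hder : ∀ s : ℝ, HasDerivAt (fun s => ∫ x in (Ω : Set (Space d)), u x * φ (x - s • h))
      (∫ x in (Ω : Set (Space d)), u x * -(fderiv ℝ φ (x - s • h) h)) s := by
    intro s
    refine (hasDerivAt_integral_of_dominated_loc_of_deriv_le (𝕜 := ℝ) (s := Set.univ)
      (F := fun s x => u x * φ (x - s • h)) (F' := fun s x => u x * -(fderiv ℝ φ (x - s • h) h))
      (bound := fun x => ‖u x‖ * (B * ‖h‖)) Filter.univ_mem (.of_forall fun t => ?_) ?_ ?_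
      (.of_forall fun x t _ => ?_) (hui.norm.mul_const _) (.of_forall fun x t _ => ?_)).2
    · exact hui.1.mul
        (φ.continuous.comp (continuous_id.sub continuous_const)).aestronglyMeasurable
    · exact hui.mul_bdd (c := A)
        (φ.continuous.comp (continuous_id.sub continuous_const)).aestronglyMeasurable
        (.of_forall fun x => hA _)
    · refine hui.1.mul (Continuous.aestronglyMeasurable ?_)
      fun_prop
    · rw [norm_mul, norm_neg]
      exact mul_le_mul_of_nonneg_left ((ContinuousLinearMap.le_opNorm _ _).trans
        (mul_le_mul_of_nonneg_right (hB _) (norm_nonneg _))) (norm_nonneg _)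
    · refine HasDerivAt.const_mul _ ?_
      have h1 : HasDerivAt (fun t : ℝ => x - t • h) (-h) t := by
        simpa using ((hasDerivAt_id t).smul_const h).const_sub x
      have h2 := ((contDiff_one_test φ).differentiable (by norm_num)
        (x - t • h)).hasFDerivAt.comp_hasDerivAt t h1
      rw [map_neg] at h2
      exact h2
  have hbound : ∀ s ∈ Set.Icc (0 : ℝ) 1,
      ‖∫ x in (Ω : Set (Space d)), u x * -(fderiv ℝ φ (x - s • h) h)‖ ≤
        ‖h‖ * ‖G‖ * ‖testL2 φ‖ := by
    intro s hs'
    -- The segment condition keeps every intermediate translate compactly supported in `Ω`, so the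
    -- weak gradient identity applies to it; translation preserves its `L₂` norm.
    let ψ : 𝓓(Ω, ℝ) := translate φ φ.contDiff φ.hasCompactSupport (s • h)
      fun y hy => hs y hy s hs'
    have h1 := isWeakGrad_iff.1 hu ψ h
    have h2 : ∀ x, fderiv ℝ ψ x = fderiv ℝ φ (x - s • h) := fun x => fderiv_comp_sub _
    simp only [h2] at h1
    simp only [mul_neg]
    rw [integral_neg, h1, neg_neg, Real.norm_eq_abs]
    refine (abs_real_inner_le_norm _ _).trans ?_
    have h3 := norm_testVecL2_le ψ h
    rw [norm_testL2_translate] at h3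
    nlinarith [norm_nonneg G]
  have := norm_image_sub_le_of_norm_deriv_le_segment_01'
    (fun s _ => (hder s).hasDerivWithinAt) (fun s hs' => hbound s ⟨hs'.1, hs'.2.le⟩)
  simpa using this

theorem norm_toLp_norm {F : Type*} [NormedAddCommGroup F] [InnerProductSpace ℝ F]
    {μ : Measure (Space d)} {f : Space d → F} (hf : MemLp f 2 μ) :
    ‖hf.norm.toLp‖ = ‖hf.toLp‖ := by
  rw [← sq_eq_sq₀ (norm_nonneg _) (norm_nonneg _), norm_toLp_sq, norm_toLp_sq]
  simp only [norm_norm]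

theorem integral_norm_mul_norm_le {F F' : Type*} [NormedAddCommGroup F] [InnerProductSpace ℝ F]
    [NormedAddCommGroup F'] [InnerProductSpace ℝ F'] {μ : Measure (Space d)} {f : Space d → F}
    {g : Space d → F'} (hf : MemLp f 2 μ) (hg : MemLp g 2 μ) :
    ∫ x, ‖f x‖ * ‖g x‖ ∂μ ≤ ‖hf.toLp‖ * ‖hg.toLp‖ := by
  rw [← norm_toLp_norm hf, ← norm_toLp_norm hg]
  refine le_trans (le_of_eq ?_) (real_inner_le_norm hf.norm.toLp hg.norm.toLp)
  rw [inner_toLp_left]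
  refine integral_congr_ae ?_
  filter_upwards [hg.norm.coeFn_toLp] with x hx
  rw [hx, RCLike.inner_apply, mul_comm]
  rfl

/-! ### The local estimate by averaging translates. -/

theorem exists_integral_abs_test_le (hb : Bornology.IsBounded (Ω : Set (Space d))) :
    ∃ V : ℝ, 0 ≤ V ∧ ∀ φ : 𝓓(Ω, ℝ), ∫ x, |φ x| ≤ V * ‖testL2 φ‖ := by
  have hfin := isFiniteMeasure_restrict hb
  have h1 : MemLp (fun _ : Space d => (1 : ℝ)) 2 (volume.restrict (Ω : Set (Space d))) :=
    memLp_const 1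
  refine ⟨‖h1.toLp‖, norm_nonneg _, fun φ => ?_⟩
  refine le_trans (le_of_eq ?_) (integral_norm_mul_norm_le h1 (memLp_test _ φ))
  rw [setIntegral_eq_integral_of_forall_compl_eq_zero fun x hx => by
    rw [test_eq_zero φ hx, norm_zero, mul_zero]]
  simp only [norm_one, one_mul, Real.norm_eq_abs]

/-- The number `(u, φ * ψ)`, with `ψ` a bump of mass one on the ball of admissible translations, is
close to `(u, φ)` up to the gradient term and is itself bounded by the functional norm `M`. -/
theorem exists_abs_inner_test_le_of_segment (hb : Bornology.IsBounded (Ω : Set (Space d)))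
    {x₀ h₀ : Space d} {ρ δ : ℝ} (hδ : 0 < δ)
    (hseg : ∀ y ∈ ball x₀ ρ, y ∈ Ω → ∀ h ∈ closedBall h₀ δ, ∀ s ∈ Set.Icc (0 : ℝ) 1,
      y + s • h ∈ Ω) :
    ∃ C : ℝ, 0 ≤ C ∧ ∀ (u : ScalarL2 Ω) (G : VectorL2 Ω) (M : ℝ), 0 ≤ M → IsWeakGrad Ω u G →
      (∀ φ : 𝓓(Ω, ℝ), |inner ℝ (testL2 φ) u| ≤ M * ‖gradL2 φ‖) →
      ∀ φ : 𝓓(Ω, ℝ), tsupport φ ⊆ ball x₀ ρ →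
        |inner ℝ (testL2 φ) u| ≤ C * (‖G‖ + M) * ‖testL2 φ‖ := by
  have hfin := isFiniteMeasure_restrict hb
  let b : ContDiffBump h₀ := ⟨δ / 2, δ, by positivity, by linarith⟩
  let ψ : Space d → ℝ := b.normed volume
  have hψs : ContDiff ℝ ((⊤ : ℕ∞) : WithTop ℕ∞) ψ := b.contDiff_normed
  have hψc : HasCompactSupport ψ := b.hasCompactSupport_normed
  have hψt : tsupport ψ = closedBall h₀ δ := b.tsupport_normed_eq
  have hψ0 : ∀ x, 0 ≤ ψ x := b.nonneg_normed
  have hψ1 : ∫ x, ψ x = 1 := b.integral_normed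
  have hψi : Integrable ψ := b.integrable_normed
  obtain ⟨V, hV0, hV⟩ := exists_integral_abs_test_le hb
  set N : ℝ := √(∫ x, ‖gradient ψ x‖ ^ 2) with hN
  have hN0 : 0 ≤ N := Real.sqrt_nonneg _
  set R : ℝ := ‖h₀‖ + δ with hR
  have hR0 : 0 ≤ R := by positivity
  refine ⟨R + N * V, by positivity, fun u G M hM hu hMu φ hφ => ?_⟩
  have hui : Integrable u (volume.restrict (Ω : Set (Space d))) :=
    (Lp.memLp u).integrable (by norm_num)
  have hφi : Integrable φ := φ.continuous.integrable_of_hasCompactSupport φ.hasCompactSupport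
  obtain ⟨A, hA⟩ := φ.continuous.bounded_above_of_compact_support φ.hasCompactSupport
  obtain ⟨B, hB⟩ := hψs.continuous.bounded_above_of_compact_support hψc
  have hint1 : Integrable (Function.uncurry fun z y => u z * φ y * ψ (z - y))
      ((volume.restrict (Ω : Set (Space d))).prod volume) :=
    (hui.mul_prod hφi).mul_bdd (c := B)
      ((hψs.continuous.comp (continuous_fst.sub continuous_snd)).aestronglyMeasurable)
      (.of_forall fun p => hB _)
  have hint2 : Integrable (Function.uncurry fun z h => u z * ψ h * φ (z - h))
      ((volume.restrict (Ω : Set (Space d))).prod volume) :=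
    (hui.mul_prod hψi).mul_bdd (c := A)
      ((φ.continuous.comp (continuous_fst.sub continuous_snd)).aestronglyMeasurable)
      (.of_forall fun p => hA _)
  -- This is `(u, φ * ψ)`. Fubini writes it as a superposition over `y` of pairings with `ψ(· - y)`,
  -- and, after `h = z - y`, over `h` of pairings with `φ(· - h)`.
  set I : ℝ := ∫ z in (Ω : Set (Space d)), ∫ y, u z * φ y * ψ (z - y) with hI
  have hI1 : I = ∫ y, φ y * ∫ z in (Ω : Set (Space d)), u z * ψ (z - y) := by
    rw [hI, integral_integral_swap hint1]
    refine integral_congr_ae (.of_forall fun y => ?_)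
    simp only
    rw [← integral_const_mul]
    refine integral_congr_ae (.of_forall fun z => ?_)
    simp only
    ring
  have hI2' : I = ∫ z in (Ω : Set (Space d)), ∫ h, u z * ψ h * φ (z - h) := by
    refine integral_congr_ae (.of_forall fun z => ?_)
    simp only
    rw [← integral_sub_left_eq_self (fun y => u z * φ y * ψ (z - y)) volume z]
    refine integral_congr_ae (.of_forall fun h => ?_)
    simp only [sub_sub_cancel]
    ring
  have hI2 : I = ∫ h, ψ h * ∫ z in (Ω : Set (Space d)), u z * φ (z - h) := by
    rw [hI2', integral_integral_swap hint2]
    refine integral_congr_ae (.of_forall fun y => ?_)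
    simp only
    rw [← integral_const_mul]
    refine integral_congr_ae (.of_forall fun z => ?_)
    simp only
    ring
  have hint3 : Integrable fun h => ψ h * ∫ z in (Ω : Set (Space d)), u z * φ (z - h) := by
    refine hint2.integral_prod_right.congr (.of_forall fun y => ?_)
    simp only [Function.uncurry]
    rw [← integral_const_mul]
    refine integral_congr_ae (.of_forall fun z => ?_)
    simp only
    ring
  have hIle : |I| ≤ N * V * M * ‖testL2 φ‖ := by
    have h1 : ∀ y, ‖φ y * ∫ z in (Ω : Set (Space d)), u z * ψ (z - y)‖ ≤ |φ y| * (M * N) := by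
      intro y
      rw [norm_mul, Real.norm_eq_abs, Real.norm_eq_abs]
      by_cases hy : φ y = 0
      · simp [hy]
      have hyt : y ∈ tsupport φ := subset_tsupport _ hy
      refine mul_le_mul_of_nonneg_left ?_ (abs_nonneg _)
      -- For `y` in the support of `φ`, the set `y + closedBall h₀ δ` lies in `Ω`; the gradient norm
      -- of this test function is `N`, whatever `y` is.
      let χ : 𝓓(Ω, ℝ) := translate ψ hψs hψc y fun h hh => by
        have := hseg y (hφ hyt) (φ.tsupport_subset hyt) h (hψt ▸ hh) 1 (by simp)
        rwa [one_smul, add_comm] at this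
      have h2 := hMu χ
      rw [inner_testL2] at h2
      have h3 : ‖gradL2 χ‖ = N := by
        rw [hN, ← norm_gradL2_translate_sq ψ hψs hψc y, Real.sqrt_sq (norm_nonneg _)]
      rw [h3] at h2
      simp only [mul_comm (u _)]
      exact h2
    rw [hI1, ← Real.norm_eq_abs]
    refine (norm_integral_le_of_norm_le (hφi.norm.mul_const (M * N)) (.of_forall h1)).trans ?_
    simp only [Real.norm_eq_abs]
    rw [integral_mul_const]
    have := mul_le_mul_of_nonneg_right (hV φ) (mul_nonneg hM hN0)
    linarith
  have hdiff : |I - inner ℝ (testL2 φ) u| ≤ R * ‖G‖ * ‖testL2 φ‖ := by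
    have e : I - inner ℝ (testL2 φ) u =
        ∫ h, (ψ h * (∫ z in (Ω : Set (Space d)), u z * φ (z - h)) -
          ψ h * ∫ z in (Ω : Set (Space d)), u z * φ z) := by
      rw [integral_sub hint3 (hψi.mul_const _), ← hI2, integral_mul_const, hψ1, inner_testL2,
        one_mul]
      simp only [mul_comm]
    rw [e, ← Real.norm_eq_abs]
    have h1 : ∀ h, ‖ψ h * (∫ z in (Ω : Set (Space d)), u z * φ (z - h)) -
        ψ h * ∫ z in (Ω : Set (Space d)), u z * φ z‖ ≤ ψ h * (R * ‖G‖ * ‖testL2 φ‖) := by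
      intro h
      rw [← mul_sub, norm_mul, Real.norm_of_nonneg (hψ0 h), Real.norm_eq_abs]
      by_cases hh : ψ h = 0
      · simp [hh]
      have hht : h ∈ closedBall h₀ δ := hψt ▸ subset_tsupport ψ hh
      refine mul_le_mul_of_nonneg_left ?_ (hψ0 h)
      refine (hu.abs_integral_translate_sub_le hb φ h fun y hy s hs =>
        hseg y (hφ hy) (φ.tsupport_subset hy) h hht s hs).trans ?_
      have : ‖h‖ ≤ R := by
        rw [mem_closedBall, dist_eq_norm] at hht
        have := norm_add_le (h - h₀) h₀
        rw [sub_add_cancel] at this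
        linarith
      gcongr
    refine (norm_integral_le_of_norm_le (hψi.mul_const _) (.of_forall h1)).trans ?_
    rw [integral_mul_const, hψ1, one_mul]
  have h1 := abs_sub_abs_le_abs_sub (inner ℝ (testL2 φ) u) I
  rw [abs_sub_comm] at h1
  -- These are the surplus cross terms when `(R + N V)(‖G‖ + M)` is expanded.
  have h2 : 0 ≤ (R * M + N * V * ‖G‖) * ‖testL2 φ‖ := by positivity
  nlinarith

/-! ### Restriction to subdomains and the global estimate. -/

/-- Extension by zero of a test function. -/
def extendTest {ω : Opens (Space d)} (h : ω ≤ Ω) (φ : 𝓓(ω, ℝ)) : 𝓓(Ω, ℝ) where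
  toFun := φ
  contDiff' := φ.contDiff
  hasCompactSupport' := φ.hasCompactSupport
  tsupport_subset' := φ.tsupport_subset.trans h

theorem extendTest_apply {ω : Opens (Space d)} (h : ω ≤ Ω) (φ : 𝓓(ω, ℝ)) (x : Space d) :
    extendTest h φ x = φ x := rfl

theorem coeFn_extendTest {ω : Opens (Space d)} (h : ω ≤ Ω) (φ : 𝓓(ω, ℝ)) :
    (extendTest h φ : Space d → ℝ) = φ := rfl

theorem norm_testL2_extendTest {ω : Opens (Space d)} (h : ω ≤ Ω) (φ : 𝓓(ω, ℝ)) :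
    ‖testL2 (extendTest h φ)‖ = ‖testL2 φ‖ := by
  rw [← sq_eq_sq₀ (norm_nonneg _) (norm_nonneg _), norm_testL2_sq, norm_testL2_sq]
  rfl

theorem coeFn_restrictL2 {F : Type*} [NormedAddCommGroup F] {ω : Opens (Space d)} (h : ω ≤ Ω)
    (u : Lp F 2 (volume.restrict (Ω : Set (Space d)))) :
    restrictL2 h u =ᵐ[volume.restrict (ω : Set (Space d))] u :=
  MemLp.coeFn_toLp _

theorem setIntegral_mono_of_zero {F : Type*} [NormedAddCommGroup F] [NormedSpace ℝ F]
    {ω : Opens (Space d)} (h : ω ≤ Ω) {f : Space d → F} (hf : ∀ x ∉ ω, f x = 0) :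
    ∫ x in (Ω : Set (Space d)), f x = ∫ x in (ω : Set (Space d)), f x := by
  rw [setIntegral_eq_integral_of_forall_compl_eq_zero fun x hx => hf x fun hx' => hx (h hx'),
    setIntegral_eq_integral_of_forall_compl_eq_zero hf]

theorem inner_testL2_restrictL2 {ω : Opens (Space d)} (h : ω ≤ Ω) (φ : 𝓓(ω, ℝ)) (u : ScalarL2 Ω) :
    inner ℝ (testL2 φ) (restrictL2 h u) = inner ℝ (testL2 (extendTest h φ)) u := by
  rw [inner_testL2, inner_testL2, setIntegral_mono_of_zero h]
  · refine integral_congr_ae ?_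
    filter_upwards [coeFn_restrictL2 h u] with x hx
    rw [hx, extendTest_apply]
  · intro x hx
    rw [extendTest_apply, test_eq_zero φ hx, zero_mul]

theorem norm_restrictL2_sq {F : Type*} [NormedAddCommGroup F] [InnerProductSpace ℝ F]
    {ω : Opens (Space d)} (h : ω ≤ Ω) (u : Lp F 2 (volume.restrict (Ω : Set (Space d)))) :
    ‖restrictL2 h u‖ ^ 2 = ∫ x in (ω : Set (Space d)), ‖u x‖ ^ 2 :=
  norm_toLp_sq _

theorem integrable_norm_sq {F : Type*} [NormedAddCommGroup F] {μ : Measure (Space d)}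
    (u : Lp F 2 μ) : Integrable (fun x => ‖u x‖ ^ 2) μ :=
  (Lp.memLp u).norm.integrable_sq

/-- The pieces may overlap: only subadditivity of the measure is involved. This replaces a partition
of unity. -/
theorem norm_sq_le_sum_of_cover {ι : Type*} (t : Finset ι) (ω : ι → Opens (Space d))
    (h : ∀ i, ω i ≤ Ω) (hc : (Ω : Set (Space d)) ⊆ ⋃ i ∈ t, (ω i : Set (Space d)))
    (u : ScalarL2 Ω) : ‖u‖ ^ 2 ≤ ∑ i ∈ t, ‖restrictL2 (h i) u‖ ^ 2 := by
  have hi := integrable_norm_sq u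
  have hii : ∀ i ∈ t, Integrable (fun x => ‖u x‖ ^ 2)
      (volume.restrict (ω i : Set (Space d))) := fun i _ =>
    hi.mono_measure (Measure.restrict_mono (h i) le_rfl)
  simp only [norm_restrictL2_sq]
  rw [norm_sq_eq_integral, ← integral_finsetSum_measure hii]
  refine integral_mono_measure ?_ (.of_forall fun x => by positivity)
    (integrable_finsetSum_measure.2 hii)
  refine (Measure.restrict_mono hc le_rfl).trans ?_
  refine Measure.le_iff.2 fun s hs => ?_
  rw [Measure.restrict_apply hs, Measure.finsetSum_apply, Set.inter_iUnion₂]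
  refine (measure_biUnion_finset_le t _).trans (le_of_eq ?_)
  exact Finset.sum_congr rfl fun i _ => (Measure.restrict_apply hs).symm

/-- On a bounded Lipschitz domain the `L₂` norm of an `H¹` function is controlled by the norm
of its gradient and its norm as a functional on `H¹₀`. -/
theorem IsLipschitzDomain.exists_norm_le (hΩ : IsLipschitzDomain Ω) :
    ∃ C : ℝ, 0 ≤ C ∧ ∀ (u : ScalarL2 Ω) (G : VectorL2 Ω) (M : ℝ), 0 ≤ M → IsWeakGrad Ω u G →
      (∀ φ : 𝓓(Ω, ℝ), |inner ℝ (testL2 φ) u| ≤ M * ‖gradL2 φ‖) → ‖u‖ ≤ C * (‖G‖ + M) := by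
  have hloc : ∀ x : Space d, x ∈ closure (Ω : Set (Space d)) → ∃ ρ C : ℝ, 0 < ρ ∧ 0 ≤ C ∧
      ∀ (u : ScalarL2 Ω) (G : VectorL2 Ω) (M : ℝ), 0 ≤ M → IsWeakGrad Ω u G →
      (∀ φ : 𝓓(Ω, ℝ), |inner ℝ (testL2 φ) u| ≤ M * ‖gradL2 φ‖) →
      ∀ φ : 𝓓(Ω, ℝ), tsupport φ ⊆ ball x ρ →
        |inner ℝ (testL2 φ) u| ≤ C * (‖G‖ + M) * ‖testL2 φ‖ := by
    intro x hx
    obtain ⟨ρ, δ, h₀, hρ, hδ, hseg⟩ := hΩ.exists_segment_subset hx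
    obtain ⟨C, hC, h⟩ := exists_abs_inner_test_le_of_segment hΩ.bounded hδ hseg
    exact ⟨ρ, C, hρ, hC, h⟩
  choose! ρ C hρ hC hle using hloc
  obtain ⟨t, ht, hcov⟩ := hΩ.bounded.isCompact_closure.elim_nhds_subcover (fun x => ball x (ρ x))
    fun x hx => ball_mem_nhds x (hρ x hx)
  let ω : Space d → Opens (Space d) := fun x => ⟨ball x (ρ x), isOpen_ball⟩ ⊓ Ω
  have hω : ∀ x, ω x ≤ Ω := fun x => inf_le_right
  refine ⟨√(∑ x ∈ t, C x ^ 2), Real.sqrt_nonneg _, fun u G M hM hu hMu => ?_⟩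
  have h1 : ∀ x ∈ t, ‖restrictL2 (hω x) u‖ ≤ C x * (‖G‖ + M) := by
    intro x hx
    have hC0 := hC x (ht x hx)
    refine norm_le_of_test_le _ (by positivity) fun φ => ?_
    rw [inner_testL2_restrictL2, ← norm_testL2_extendTest (hω x) φ]
    exact hle x (ht x hx) u G M hM hu hMu _ (φ.tsupport_subset.trans inf_le_left)
  have h2 := norm_sq_le_sum_of_cover t ω hω (fun y hy => by
    obtain ⟨x, hx, hyx⟩ := Set.mem_iUnion₂.1 (hcov (subset_closure hy))
    exact Set.mem_iUnion₂.2 ⟨x, hx, hyx, hy⟩) u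
  have h3 : ‖u‖ ^ 2 ≤ (∑ x ∈ t, C x ^ 2) * (‖G‖ + M) ^ 2 := by
    refine h2.trans ?_
    rw [Finset.sum_mul]
    refine Finset.sum_le_sum fun x hx => ?_
    rw [← mul_pow]
    exact pow_le_pow_left₀ (norm_nonneg _) (h1 x hx) 2
  have hGM : 0 ≤ ‖G‖ + M := by positivity
  rw [← Real.sqrt_sq hGM, ← Real.sqrt_mul (by positivity)]
  exact Real.le_sqrt_of_sq_le h3

/-! ### The Friedrichs inequality. -/

/-- Integration by parts along `e` against the linear function `⟪e, x⟫`, whose derivative in that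
direction is `1`. -/
theorem integral_test_sq_eq (φ : 𝓓(Ω, ℝ)) {e : Space d} (he : ‖e‖ = 1) :
    ∫ x, φ x ^ 2 = -∫ x, inner ℝ e x * (2 * φ x * fderiv ℝ φ x e) := by
  let L : Space d →L[ℝ] ℝ := innerSL ℝ e
  have hL : L e = 1 := by
    change inner ℝ e e = 1
    rw [real_inner_self_eq_norm_sq, he]
    norm_num
  have hc : Continuous fun x => fderiv ℝ φ x e :=
    ((contDiff_one_test φ).continuous_fderiv (by norm_num)).clm_apply continuous_const
  have hφc : Continuous φ := φ.continuous
  have hdiff : Differentiable ℝ φ := (contDiff_one_test φ).differentiable (by norm_num)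
  have hf2 : ∀ x, fderiv ℝ (fun x => φ x ^ 2) x e = 2 * φ x * fderiv ℝ φ x e := by
    intro x
    rw [((hdiff x).hasFDerivAt.pow 2).fderiv]
    simp
  have hcs : HasCompactSupport fun x => φ x ^ 2 :=
    φ.hasCompactSupport.comp_left (g := fun t : ℝ => t ^ 2) (by norm_num)
  have hcs' : HasCompactSupport fun x => 2 * φ x * fderiv ℝ φ x e :=
    (φ.hasCompactSupport.mul_left (f := fun _ => (2 : ℝ))).mul_right
  have h1 : Integrable fun x => φ x ^ 2 :=
    (hφc.pow 2).integrable_of_hasCompactSupport hcs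
  have h2 : Integrable fun x => L x * (2 * φ x * fderiv ℝ φ x e) :=
    (L.continuous.mul ((continuous_const.mul hφc).mul hc)).integrable_of_hasCompactSupport
      hcs'.mul_left
  have h3 : Integrable fun x => L x * φ x ^ 2 :=
    (L.continuous.mul (hφc.pow 2)).integrable_of_hasCompactSupport hcs.mul_left
  have key := integral_mul_fderiv_eq_neg_fderiv_mul_of_integrable (μ := volume) (f := L)
    (g := fun x => φ x ^ 2) (v := e)
    (by simpa only [ContinuousLinearMap.fderiv, hL, one_mul] using h1)
    (by simpa only [hf2] using h2) h3 (fun x _ => L.differentiableAt)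
    (fun x _ => (hdiff.pow 2) x)
  simp only [ContinuousLinearMap.fderiv, hL, one_mul, hf2] at key
  exact (neg_eq_iff_eq_neg.2 key).symm

/-- The Friedrichs inequality for test functions. -/
theorem exists_norm_testL2_le (hd : 0 < d) (hb : Bornology.IsBounded (Ω : Set (Space d))) :
    ∃ C : ℝ, 0 ≤ C ∧ ∀ φ : 𝓓(Ω, ℝ), ‖testL2 φ‖ ≤ C * ‖gradL2 φ‖ := by
  obtain ⟨R, hR⟩ := hb.subset_closedBall 0
  obtain ⟨e, he⟩ : ∃ e : Space d, ‖e‖ = 1 := ⟨EuclideanSpace.single ⟨0, hd⟩ 1, by simp⟩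
  refine ⟨2 * |R|, by positivity, fun φ => ?_⟩
  have h1 : ‖testL2 φ‖ ^ 2 =
      -∫ x in (Ω : Set (Space d)), inner ℝ e x * (2 * φ x * fderiv ℝ φ x e) := by
    rw [norm_testL2_sq, integral_test_sq_eq φ he,
      setIntegral_eq_integral_of_forall_compl_eq_zero]
    intro x hx
    rw [test_eq_zero φ hx]
    ring
  have h2 : |∫ x in (Ω : Set (Space d)), inner ℝ e x * (2 * φ x * fderiv ℝ φ x e)| ≤
      ∫ x in (Ω : Set (Space d)), (2 * |R|) * (‖φ x‖ * ‖gradient φ x‖) := by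
    rw [← Real.norm_eq_abs]
    refine norm_integral_le_of_norm_le
      (((memLp_test _ φ).norm.integrable_mul (memLp_gradient_test _ φ).norm).const_mul _) ?_
    filter_upwards [ae_restrict_mem Ω.isOpen.measurableSet] with x hx
    have hx' : |inner ℝ e x| ≤ |R| := by
      have h3 := hR hx
      rw [mem_closedBall_zero_iff] at h3
      refine (abs_real_inner_le_norm e x).trans ?_
      rw [he, one_mul]
      exact h3.trans (le_abs_self R)
    have hx2 : |fderiv ℝ φ x e| ≤ ‖gradient φ x‖ := by
      rw [← inner_gradient_left]
      refine (abs_real_inner_le_norm _ _).trans ?_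
      rw [he, mul_one]
    rw [Real.norm_eq_abs, Real.norm_eq_abs, abs_mul, abs_mul, abs_mul, abs_two]
    calc |inner ℝ e x| * (2 * |φ x| * |fderiv ℝ φ x e|)
        ≤ |R| * (2 * |φ x| * ‖gradient φ x‖) := by gcongr
      _ = _ := by ring
  rw [integral_const_mul] at h2
  have h3 := integral_norm_mul_norm_le (memLp_test (volume.restrict (Ω : Set (Space d))) φ)
    (memLp_gradient_test (volume.restrict (Ω : Set (Space d))) φ)
  have h4 := neg_le_abs
    (∫ x in (Ω : Set (Space d)), inner ℝ e x * (2 * φ x * fderiv ℝ φ x e))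
  have h5 := mul_le_mul_of_nonneg_left h3 (by positivity : 0 ≤ 2 * |R|)
  have hbd : ‖testL2 φ‖ ^ 2 ≤ 2 * |R| * (‖testL2 φ‖ * ‖gradL2 φ‖) := by
    rw [h1]
    exact h4.trans (h2.trans h5)
  rcases (norm_nonneg (testL2 φ)).eq_or_lt with h0 | h0
  · rw [← h0]; positivity
  · rw [sq, mul_left_comm] at hbd
    exact le_of_mul_le_mul_left hbd h0

/-! ### The mixed problem in abstract Hilbert spaces. -/

section Abstract

variable {X Y H K : Type*}
  [NormedAddCommGroup X] [InnerProductSpace ℝ X]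
  [NormedAddCommGroup Y] [InnerProductSpace ℝ Y]
  [NormedAddCommGroup H] [InnerProductSpace ℝ H]
  [NormedAddCommGroup K] [InnerProductSpace ℝ K]

/-- The mixed variational problem: `(q, w) + (Dp, Dw) = (g₂, w) + (g₃, Dw)` for all `w ∈ X` and
`(Dq, Dz) - (p, z) = -(g₄, z) - (g₁, Dz)` for all `z ∈ Y`. -/
def SolvesWeak (ι₀ : X →L[ℝ] H) (D₀ : X →L[ℝ] K) (ι₁ : Y →L[ℝ] H) (D₁ : Y →L[ℝ] K)
    (g₁ : K) (g₂ : H) (g₃ : K) (g₄ : H) (p : X) (q : Y) : Prop :=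
  (∀ w, inner ℝ (ι₁ q) (ι₀ w) + inner ℝ (D₀ p) (D₀ w) =
    inner ℝ g₂ (ι₀ w) + inner ℝ g₃ (D₀ w)) ∧
  ∀ z, inner ℝ (D₁ q) (D₁ z) - inner ℝ (ι₀ p) (ι₁ z) = -inner ℝ g₄ (ι₁ z) - inner ℝ g₁ (D₁ z)

/-- The Lax–Milgram theorem, in the form needed to solve equations with `T`. -/
theorem exists_rightInverse_of_coercive [CompleteSpace X] (T : X →L[ℝ] X) {κ : ℝ} (hκ : 0 < κ)
    (h : ∀ x, ‖x‖ ^ 2 * κ ≤ inner ℝ (T x) x) : ∃ S : X →L[ℝ] X, ∀ x, T (S x) = x := by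
  lift κ to NNReal using hκ.le
  obtain ⟨S, hS, -⟩ := isUnit_iff_exists.1 (T.isUnit_of_forall_le_norm_inner_map
    (NNReal.coe_pos.1 hκ) fun x => (h x).trans (le_abs_self _))
  exact ⟨S, fun x => congrArg (fun A : X →L[ℝ] X => A x) hS⟩

/-- Schur complement: the first equation gives `p = r - R (ι₁ q)`, and inserting this in the second
leaves a coercive problem for `q` alone. -/
theorem exists_solvesWeak [CompleteSpace X] [CompleteSpace Y] [CompleteSpace H] [CompleteSpace K]
    {ι₀ : X →L[ℝ] H} {D₀ : X →L[ℝ] K} {ι₁ : Y →L[ℝ] H} {D₁ : Y →L[ℝ] K} {c C : ℝ}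
    (hc : 0 < c) (hX : ∀ x, ‖x‖ ≤ c * ‖D₀ x‖) (hC : 0 < C)
    (hY : ∀ q M, 0 ≤ M → (∀ w, |inner ℝ (ι₁ q) (ι₀ w)| ≤ M * ‖D₀ w‖) → ‖q‖ ≤ C * (‖D₁ q‖ + M))
    (g₁ : K) (g₂ : H) (g₃ : K) (g₄ : H) :
    ∃ p q, SolvesWeak ι₀ D₀ ι₁ D₁ g₁ g₂ g₃ g₄ p q := by
  obtain ⟨T₀, hT₀⟩ : ∃ T : X →L[ℝ] X, ∀ x y, inner ℝ (T x) y = inner ℝ (D₀ x) (D₀ y) :=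
    ⟨D₀.adjoint ∘L D₀, fun x y => by
      rw [ContinuousLinearMap.comp_apply, ContinuousLinearMap.adjoint_inner_left]⟩
  obtain ⟨S, hS⟩ := exists_rightInverse_of_coercive T₀ (κ := (c ^ 2)⁻¹) (by positivity) fun x => by
    rw [hT₀, real_inner_self_eq_norm_sq, mul_inv_le_iff₀ (by positivity)]
    have := pow_le_pow_left₀ (norm_nonneg x) (hX x) 2
    linarith [mul_pow c ‖D₀ x‖ 2]
  obtain ⟨R, hR⟩ : ∃ R : H →L[ℝ] X, ∀ f w, inner ℝ (D₀ (R f)) (D₀ w) = inner ℝ f (ι₀ w) := by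
    refine ⟨S ∘L ι₀.adjoint, fun f w => ?_⟩
    rw [← hT₀, ContinuousLinearMap.comp_apply, hS, ContinuousLinearMap.adjoint_inner_left]
  obtain ⟨T₁, hT₁⟩ : ∃ T : Y →L[ℝ] Y, ∀ x y, inner ℝ (T x) y =
      inner ℝ (ι₀ (R (ι₁ x))) (ι₁ y) + inner ℝ (D₁ x) (D₁ y) := by
    refine ⟨ι₁.adjoint ∘L (ι₀ ∘L R ∘L ι₁) + D₁.adjoint ∘L D₁, fun x y => ?_⟩
    rw [add_apply, inner_add_left]
    simp only [ContinuousLinearMap.comp_apply, ContinuousLinearMap.adjoint_inner_left]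
  -- `hY` is used with `M = ‖D₀ (R (ι₁ q))‖`; the factor `2` comes from `(a + b)² ≤ 2 (a² + b²)`.
  obtain ⟨S₁, hS₁⟩ := exists_rightInverse_of_coercive T₁ (κ := (2 * C ^ 2)⁻¹) (by positivity)
    fun q => by
      have h1 : inner ℝ (T₁ q) q = ‖D₀ (R (ι₁ q))‖ ^ 2 + ‖D₁ q‖ ^ 2 := by
        rw [hT₁, real_inner_comm, ← hR, real_inner_self_eq_norm_sq, real_inner_self_eq_norm_sq]
      have h2 := hY q ‖D₀ (R (ι₁ q))‖ (norm_nonneg _) fun w => by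
        rw [← hR]
        exact abs_real_inner_le_norm _ _
      rw [h1, mul_inv_le_iff₀ (by positivity)]
      have h3 := pow_le_pow_left₀ (norm_nonneg q) h2 2
      rw [mul_pow] at h3
      have h4 := mul_nonneg (sq_nonneg C) (sq_nonneg (‖D₁ q‖ - ‖D₀ (R (ι₁ q))‖))
      linarith
  obtain ⟨r, hr⟩ : ∃ r : X, ∀ w, inner ℝ (D₀ r) (D₀ w) =
      inner ℝ g₂ (ι₀ w) + inner ℝ g₃ (D₀ w) := by
    refine ⟨S (ι₀.adjoint g₂ + D₀.adjoint g₃), fun w => ?_⟩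
    rw [← hT₀, hS, inner_add_left, ContinuousLinearMap.adjoint_inner_left,
      ContinuousLinearMap.adjoint_inner_left]
  obtain ⟨q, hq⟩ : ∃ q : Y, T₁ q = ι₁.adjoint (ι₀ r - g₄) - D₁.adjoint g₁ := ⟨S₁ _, hS₁ _⟩
  refine ⟨r - R (ι₁ q), q, fun w => ?_, fun z => ?_⟩
  · rw [map_sub, inner_sub_left, hr, hR]
    ring
  · have h := hT₁ q z
    rw [hq, inner_sub_left, ContinuousLinearMap.adjoint_inner_left,
      ContinuousLinearMap.adjoint_inner_left, inner_sub_left] at h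
    rw [map_sub, inner_sub_left]
    linarith

/-- Energy estimate: the first equation bounds `q` as a functional by `‖D₀ p‖` plus data, so both
norms are controlled by `‖D₀ p‖ + ‖D₁ q‖` and data, and the energy identity bounds that sum. -/
theorem SolvesWeak.exists_norm_le {ι₀ : X →L[ℝ] H} {D₀ : X →L[ℝ] K} {ι₁ : Y →L[ℝ] H}
    {D₁ : Y →L[ℝ] K} {c C : ℝ} (hι₀ : ∀ x, ‖ι₀ x‖ ≤ ‖x‖) (hD₀ : ∀ x, ‖D₀ x‖ ≤ ‖x‖)
    (hι₁ : ∀ x, ‖ι₁ x‖ ≤ ‖x‖) (hD₁ : ∀ x, ‖D₁ x‖ ≤ ‖x‖)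
    (hc : 0 < c) (hX : ∀ x, ‖x‖ ≤ c * ‖D₀ x‖) (hC : 0 < C)
    (hY : ∀ q M, 0 ≤ M → (∀ w, |inner ℝ (ι₁ q) (ι₀ w)| ≤ M * ‖D₀ w‖) →
      ‖q‖ ≤ C * (‖D₁ q‖ + M)) :
    ∃ A : ℝ, 0 ≤ A ∧ ∀ g₁ g₂ g₃ g₄ p q, SolvesWeak ι₀ D₀ ι₁ D₁ g₁ g₂ g₃ g₄ p q →
      ‖p‖ ≤ A * (‖g₁‖ + ‖g₂‖ + ‖g₃‖ + ‖g₄‖) ∧ ‖q‖ ≤ A * (‖g₁‖ + ‖g₂‖ + ‖g₃‖ + ‖g₄‖) := by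
  -- If `N = ‖D₀ p‖ + ‖D₁ q‖` exceeded `B γ`, then `N ≥ γ`, and `N² ≤ 2γ ((c + C) N + C c γ)` would
  -- give `N² ≤ (B - 1) γ N`, contradicting `N² > B γ N`.
  set B : ℝ := 2 * (c + C) + 2 * (C * c) + 1 with hB
  have hcC : 0 < C * c := by positivity
  refine ⟨c * B + C * (B + c), by positivity, fun g₁ g₂ g₃ g₄ p q hpq => ?_⟩
  set γ : ℝ := ‖g₁‖ + ‖g₂‖ + ‖g₃‖ + ‖g₄‖ with hγ
  have n1 := norm_nonneg g₁
  have n2 := norm_nonneg g₂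
  have n3 := norm_nonneg g₃
  have n4 := norm_nonneg g₄
  have hγ0 : 0 ≤ γ := by positivity
  have bd : ∀ (f : H) (g : K) (x : H) (y : K) (t : ℝ), ‖x‖ ≤ t → ‖y‖ ≤ t → ‖f‖ + ‖g‖ ≤ γ →
      |inner ℝ f x + inner ℝ g y| ≤ γ * t := by
    intro f g x y t hx hy hfg
    have ht : 0 ≤ t := (norm_nonneg x).trans hx
    calc |inner ℝ f x + inner ℝ g y| ≤ ‖f‖ * ‖x‖ + ‖g‖ * ‖y‖ :=
          (abs_add_le _ _).trans (add_le_add (abs_real_inner_le_norm _ _)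
            (abs_real_inner_le_norm _ _))
      _ ≤ ‖f‖ * t + ‖g‖ * t := by gcongr
      _ = (‖f‖ + ‖g‖) * t := by ring
      _ ≤ γ * t := by gcongr
  have hp := hX p
  have hq : ‖q‖ ≤ C * (‖D₁ q‖ + (‖D₀ p‖ + γ * c)) := by
    refine hY q _ (by positivity) fun w => ?_
    have h1 := hpq.1 w
    have h2 := bd g₂ g₃ _ _ ‖w‖ (hι₀ w) (hD₀ w) (by linarith)
    have h3 := abs_real_inner_le_norm (D₀ p) (D₀ w)
    have h4 : inner ℝ (ι₁ q) (ι₀ w) =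
        (inner ℝ g₂ (ι₀ w) + inner ℝ g₃ (D₀ w)) - inner ℝ (D₀ p) (D₀ w) := by linarith
    rw [h4]
    refine (abs_sub _ _).trans ?_
    have h5 := mul_le_mul_of_nonneg_left (hX w) hγ0
    linarith
  -- Taking `w = p` and `z = q` and adding, the coupling terms `(q, p)` and `-(p, q)` cancel.
  have hen : ‖D₀ p‖ ^ 2 + ‖D₁ q‖ ^ 2 ≤ γ * ‖p‖ + γ * ‖q‖ := by
    have h1 := hpq.1 p
    have h2 := hpq.2 q
    rw [real_inner_self_eq_norm_sq] at h1 h2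
    have h3 := le_of_abs_le (bd g₂ g₃ _ _ ‖p‖ (hι₀ p) (hD₀ p) (by linarith))
    have h4 := neg_le_of_abs_le (bd g₄ g₁ _ _ ‖q‖ (hι₁ q) (hD₁ q) (by linarith))
    rw [real_inner_comm] at h1
    linarith
  set a := ‖D₀ p‖
  set b := ‖D₁ q‖
  have ha : 0 ≤ a := norm_nonneg _
  have hb : 0 ≤ b := norm_nonneg _
  have hN : a + b ≤ B * γ := by
    by_contra! hlt
    have hB1 : 1 ≤ B := by rw [hB]; linarith
    have hγN : γ ≤ a + b := by nlinarith
    have h1 : (a + b) ^ 2 ≤ 2 * γ * ((c + C) * (a + b) + C * c * γ) := by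
      have e1 := mul_le_mul_of_nonneg_left hp hγ0
      have e2 := mul_le_mul_of_nonneg_left hq hγ0
      have e3 : 0 ≤ γ * (c * b) := by positivity
      nlinarith [sq_nonneg (a - b)]
    have hNpos : 0 < a + b := lt_of_le_of_lt (by positivity) hlt
    have h2 : B * γ * (a + b) < (a + b) ^ 2 := by nlinarith
    have h3 : C * c * γ * γ ≤ C * c * γ * (a + b) :=
      mul_le_mul_of_nonneg_left hγN (by positivity)
    have h4 : 0 ≤ γ * (a + b) := by positivity
    rw [hB] at h2
    nlinarith
  have h1 : a ≤ B * γ := by linarith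
  have hBγ : 0 ≤ B * γ := by linarith
  constructor
  · have e1 : c * a ≤ c * (B * γ) := by gcongr
    have e2 : 0 ≤ C * (B + c) * γ := by positivity
    linarith
  · have e1 : C * (b + (a + γ * c)) ≤ C * (B * γ + γ * c) :=
      mul_le_mul_of_nonneg_left (by linarith) hC.le
    have e2 : 0 ≤ c * B * γ := by positivity
    linarith

end Abstract

/-! ### `H¹` and `H¹₀` as closed graph spaces. -/

theorem weakGrad_eq {u : ScalarL2 Ω} {G : VectorL2 Ω} (h : IsWeakGrad Ω u G) :
    weakGrad Ω u = G := by
  have hex : ∃ G, IsWeakGrad Ω u G := ⟨G, h⟩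
  rw [weakGrad, dif_pos hex]
  exact hex.choose_spec.unique h

theorem weakDiv_eq {v : VectorL2 Ω} {w : ScalarL2 Ω} (h : IsWeakDiv Ω v w) :
    weakDiv Ω v = w := by
  have hex : ∃ w, IsWeakDiv Ω v w := ⟨w, h⟩
  rw [weakDiv, dif_pos hex]
  exact hex.choose_spec.unique h

theorem isWeakGrad_weakGrad {u : ScalarL2 Ω} (h : u ∈ H1 Ω) : IsWeakGrad Ω u (weakGrad Ω u) := by
  obtain ⟨G, hG⟩ := h
  rwa [weakGrad_eq hG]

theorem isWeakDiv_weakDiv {v : VectorL2 Ω} (h : v ∈ Hdiv Ω) : IsWeakDiv Ω v (weakDiv Ω v) := by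
  obtain ⟨w, hw⟩ := h
  rwa [weakDiv_eq hw]

theorem memLp_fderiv_test (μ : Measure (Space d)) [IsFiniteMeasureOnCompacts μ] (φ : 𝓓(Ω, ℝ))
    (c : Space d) : MemLp (fun x => fderiv ℝ φ x c) 2 μ :=
  (((contDiff_one_test φ).continuous_fderiv (by norm_num)).clm_apply
    continuous_const).memLp_of_hasCompactSupport (φ.hasCompactSupport.fderiv_apply ℝ c)

theorem isWeakGrad_iff_inner {u : ScalarL2 Ω} {G : VectorL2 Ω} :
    IsWeakGrad Ω u G ↔ ∀ (φ : 𝓓(Ω, ℝ)) (c : Space d),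
      inner ℝ (memLp_fderiv_test (volume.restrict (Ω : Set (Space d))) φ c).toLp u +
        inner ℝ (testVecL2 φ c) G = 0 := by
  rw [isWeakGrad_iff]
  refine forall₂_congr fun φ c => ?_
  rw [← eq_neg_iff_add_eq_zero, inner_toLp_left]
  rfl

theorem inner_toLp_toLp {F : Type*} [NormedAddCommGroup F] [InnerProductSpace ℝ F]
    {μ : Measure (Space d)} {f g : Space d → F} (hf : MemLp f 2 μ) (hg : MemLp g 2 μ) :
    inner ℝ hf.toLp hg.toLp = ∫ x, inner ℝ (f x) (g x) ∂μ := by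
  rw [inner_toLp_left]
  refine integral_congr_ae ?_
  filter_upwards [hg.coeFn_toLp] with x hx
  rw [hx]

theorem isWeakGrad_test (φ : 𝓓(Ω, ℝ)) : IsWeakGrad Ω (testL2 φ) (gradL2 φ) := by
  rw [isWeakGrad_iff_inner]
  intro ψ c
  have hf : ∀ χ : 𝓓(Ω, ℝ), Differentiable ℝ χ := fun χ =>
    (contDiff_one_test χ).differentiable (by norm_num)
  have hd : ∀ χ : 𝓓(Ω, ℝ), Continuous fun x => fderiv ℝ χ x c := fun χ =>
    ((contDiff_one_test χ).continuous_fderiv (by norm_num)).clm_apply continuous_const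
  have key := integral_mul_fderiv_eq_neg_fderiv_mul_of_integrable (μ := volume) (f := φ)
    (g := ψ) (v := c)
    (((hd φ).mul ψ.continuous).integrable_of_hasCompactSupport ψ.hasCompactSupport.mul_left)
    ((φ.continuous.mul (hd ψ)).integrable_of_hasCompactSupport φ.hasCompactSupport.mul_right)
    ((φ.continuous.mul ψ.continuous).integrable_of_hasCompactSupport φ.hasCompactSupport.mul_right)
    (fun x _ => hf φ x) (fun x _ => hf ψ x)
  rw [testL2, testVecL2, gradL2, inner_toLp_toLp, inner_toLp_toLp,
    setIntegral_eq_integral_of_forall_compl_eq_zero fun x hx => by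
      rw [test_eq_zero φ hx, inner_zero_right],
    setIntegral_eq_integral_of_forall_compl_eq_zero fun x hx => by
      rw [test_eq_zero ψ hx, zero_smul, inner_zero_left]]
  simp only [inner_gradient_right, RCLike.inner_apply, conj_trivial, map_smul, smul_eq_mul]
  rw [key, neg_add_eq_zero]
  simp only [mul_comm]

/-- Pairs `(u, ∇u)` with `u ∈ H¹(Ω)`, as a subspace of `L₂(Ω) × 𝐋₂(Ω)`. -/
def h1Graph (Ω : Opens (Space d)) : Submodule ℝ (WithLp 2 (ScalarL2 Ω × VectorL2 Ω)) where
  carrier := {p | IsWeakGrad Ω p.fst p.snd}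
  zero_mem' := isWeakGrad_iff_inner.2 fun φ c => by simp
  add_mem' {p q} hp hq := isWeakGrad_iff_inner.2 fun φ c => by
    have h1 := isWeakGrad_iff_inner.1 hp φ c
    have h2 := isWeakGrad_iff_inner.1 hq φ c
    rw [WithLp.add_fst, WithLp.add_snd, inner_add_right, inner_add_right]
    linarith
  smul_mem' a p hp := isWeakGrad_iff_inner.2 fun φ c => by
    have h1 := isWeakGrad_iff_inner.1 hp φ c
    rw [WithLp.smul_fst, WithLp.smul_snd, real_inner_smul_right, real_inner_smul_right, ← mul_add,
      h1, mul_zero]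

theorem mem_h1Graph {p : WithLp 2 (ScalarL2 Ω × VectorL2 Ω)} :
    p ∈ h1Graph Ω ↔ IsWeakGrad Ω p.fst p.snd := Iff.rfl

theorem isClosed_h1Graph : IsClosed (h1Graph Ω : Set (WithLp 2 (ScalarL2 Ω × VectorL2 Ω))) := by
  have : (h1Graph Ω : Set (WithLp 2 (ScalarL2 Ω × VectorL2 Ω))) =
      ⋂ (φ : 𝓓(Ω, ℝ)) (c : Space d),
        {p | inner ℝ (memLp_fderiv_test (volume.restrict (Ω : Set (Space d))) φ c).toLp p.fst +
          inner ℝ (testVecL2 φ c) p.snd = 0} := by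
    ext p
    simp only [SetLike.mem_coe, mem_h1Graph, isWeakGrad_iff_inner, Set.mem_iInter,
      Set.mem_ofPred_eq]
  rw [this]
  refine isClosed_iInter fun φ => isClosed_iInter fun c => isClosed_eq ?_ continuous_const
  exact (continuous_const.inner (WithLp.fstL 2 ℝ (ScalarL2 Ω) (VectorL2 Ω)).continuous).add
    (continuous_const.inner (WithLp.sndL 2 ℝ (ScalarL2 Ω) (VectorL2 Ω)).continuous)

/-- The pairs `(φ, ∇φ)` of test functions, as a subspace of `L₂(Ω) × 𝐋₂(Ω)`. -/
def testGraph (Ω : Opens (Space d)) : Submodule ℝ (ScalarL2 Ω × VectorL2 Ω) where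
  carrier := testPairs Ω
  zero_mem' := by
    refine ⟨0, Lp.coeFn_zero _ _ _, (Lp.coeFn_zero _ _ _).trans (.of_forall fun x => ?_)⟩
    exact (gradient_const x (0 : ℝ)).symm
  add_mem' := by
    rintro p q ⟨φ, h1, h2⟩ ⟨ψ, h3, h4⟩
    refine ⟨φ + ψ, ?_, ?_⟩
    · filter_upwards [Lp.coeFn_add p.1 q.1, h1, h3] with x hx h1 h3
      rw [Prod.fst_add, hx, Pi.add_apply, h1, h3]
      rfl
    · filter_upwards [Lp.coeFn_add p.2 q.2, h2, h4] with x hx h2 h4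
      have := fderiv_add ((contDiff_one_test φ).differentiable (by norm_num) x)
        ((contDiff_one_test ψ).differentiable (by norm_num) x)
      rw [Prod.snd_add, hx, Pi.add_apply, h2, h4, gradient, gradient, gradient, ← map_add, ← this]
      rfl
  smul_mem' := by
    rintro a p ⟨φ, h1, h2⟩
    refine ⟨a • φ, ?_, ?_⟩
    · filter_upwards [Lp.coeFn_smul a p.1, h1] with x hx h1
      rw [Prod.smul_fst, hx, Pi.smul_apply, h1]
      rfl
    · filter_upwards [Lp.coeFn_smul a p.2, h2] with x hx h2
      have := fderiv_const_smul ((contDiff_one_test φ).differentiable (by norm_num) x) a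
      rw [Prod.smul_snd, hx, Pi.smul_apply, h2]
      refine ext_inner_right ℝ fun c => ?_
      rw [real_inner_smul_left, inner_gradient_left, inner_gradient_left]
      exact (congrArg (fun L : Space d →L[ℝ] ℝ => L c) this).symm

/-- Pairs `(u, ∇u)` with `u ∈ H¹₀(Ω)`, as a subspace of `L₂(Ω) × 𝐋₂(Ω)`. -/
def h10Graph (Ω : Opens (Space d)) : Submodule ℝ (WithLp 2 (ScalarL2 Ω × VectorL2 Ω)) :=
  (testGraph Ω).topologicalClosure.comap
    (WithLp.prodContinuousLinearEquiv 2 ℝ (ScalarL2 Ω) (VectorL2 Ω)).toLinearMap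

theorem mem_h10Graph {p : WithLp 2 (ScalarL2 Ω × VectorL2 Ω)} :
    p ∈ h10Graph Ω ↔ (p.fst, p.snd) ∈ closure (testPairs Ω) := Iff.rfl

theorem isClosed_h10Graph : IsClosed (h10Graph Ω : Set (WithLp 2 (ScalarL2 Ω × VectorL2 Ω))) :=
  (isClosed_closure (s := testPairs Ω)).preimage
    (WithLp.prodContinuousLinearEquiv 2 ℝ (ScalarL2 Ω) (VectorL2 Ω)).continuous

/-- Density principle by which identities and inequalities for test functions pass to `H¹₀`. -/
theorem forall_mem_closure_testPairs {P : ScalarL2 Ω × VectorL2 Ω → Prop}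
    (hP : IsClosed {p | P p}) (h : ∀ φ : 𝓓(Ω, ℝ), P (testL2 φ, gradL2 φ)) :
    ∀ p ∈ closure (testPairs Ω), P p := by
  refine closure_minimal (fun p hp => ?_) hP
  obtain ⟨φ, rfl⟩ := mem_testPairs_iff.1 hp
  exact h φ

theorem isWeakGrad_of_mem_closure {p : ScalarL2 Ω × VectorL2 Ω} (hp : p ∈ closure (testPairs Ω)) :
    IsWeakGrad Ω p.1 p.2 :=
  forall_mem_closure_testPairs (P := fun p => IsWeakGrad Ω p.1 p.2)
    (isClosed_h1Graph.preimage
      (WithLp.prodContinuousLinearEquiv 2 ℝ (ScalarL2 Ω) (VectorL2 Ω)).symm.continuous)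
    isWeakGrad_test p hp

theorem mem_H10_of_mem_closure {p : ScalarL2 Ω × VectorL2 Ω} (hp : p ∈ closure (testPairs Ω)) :
    p.1 ∈ H10 Ω := by
  have h := isWeakGrad_of_mem_closure hp
  exact ⟨⟨_, h⟩, by rwa [weakGrad_eq h]⟩

theorem isWeakDiv_iff_closure {v : VectorL2 Ω} {w : ScalarL2 Ω} :
    IsWeakDiv Ω v w ↔ ∀ p ∈ closure (testPairs Ω), inner ℝ p.1 w + inner ℝ p.2 v = 0 := by
  rw [isWeakDiv_iff]
  constructor
  · exact forall_mem_closure_testPairs (P := fun p => inner ℝ p.1 w + inner ℝ p.2 v = 0)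
      (isClosed_eq (by fun_prop) continuous_const)
  · exact fun h φ => h (testL2 φ, gradL2 φ) (subset_closure (mem_testPairs_iff.2 ⟨φ, rfl⟩))

/-! ### Restriction to the elements of a mesh. -/

/-- A test function on `ω` extended by zero is one on `Ω`, so no new integration by parts is needed.
-/
theorem IsWeakGrad.restrictL2 {ω : Opens (Space d)} (h : ω ≤ Ω) {u : ScalarL2 Ω} {G : VectorL2 Ω}
    (hu : IsWeakGrad Ω u G) : IsWeakGrad ω (restrictL2 h u) (restrictL2 h G) := by
  intro φ
  have key := hu (extendTest h φ)
  rw [setIntegral_mono_of_zero h fun x hx => by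
      rw [coeFn_extendTest,
        gradient_eq_zero_of_notMem_tsupport fun h' => hx (φ.tsupport_subset h'), smul_zero],
    setIntegral_mono_of_zero h fun x hx => by
      rw [extendTest_apply, test_eq_zero φ hx, zero_smul]] at key
  convert key using 1
  · refine integral_congr_ae ?_
    filter_upwards [coeFn_restrictL2 h u] with x hx
    rw [hx, coeFn_extendTest]
  · refine congrArg _ (integral_congr_ae ?_)
    filter_upwards [coeFn_restrictL2 h G] with x hx
    rw [hx, coeFn_extendTest]

theorem IsWeakDiv.restrictL2 {ω : Opens (Space d)} (h : ω ≤ Ω) {v : VectorL2 Ω} {w : ScalarL2 Ω}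
    (hv : IsWeakDiv Ω v w) : IsWeakDiv ω (restrictL2 h v) (restrictL2 h w) := by
  intro φ
  have key := hv (extendTest h φ)
  rw [setIntegral_mono_of_zero h fun x hx => by
      rw [coeFn_extendTest,
        gradient_eq_zero_of_notMem_tsupport fun h' => hx (φ.tsupport_subset h'), inner_zero_right],
    setIntegral_mono_of_zero h fun x hx => by
      rw [extendTest_apply, test_eq_zero φ hx, zero_smul]] at key
  convert key using 1
  · refine integral_congr_ae ?_
    filter_upwards [coeFn_restrictL2 h v] with x hx
    rw [hx, coeFn_extendTest]
  · refine congrArg _ (integral_congr_ae ?_)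
    filter_upwards [coeFn_restrictL2 h w] with x hx
    rw [hx, coeFn_extendTest]

theorem sum_norm_restrictL2_sq_le {F : Type*} [NormedAddCommGroup F] [InnerProductSpace ℝ F]
    (𝒯 : Mesh Ω) (u : Lp F 2 (volume.restrict (Ω : Set (Space d)))) :
    ∑ i, ‖restrictL2 (𝒯.subset i) u‖ ^ 2 ≤ ‖u‖ ^ 2 := by
  have hi := integrable_norm_sq u
  simp only [norm_restrictL2_sq]
  rw [norm_sq_eq_integral, ← integral_iUnion_fintype (fun i => (𝒯.elem i).isOpen.measurableSet)
    𝒯.disjoint fun i => hi.mono_measure (Measure.restrict_mono (𝒯.subset i) le_rfl)]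
  exact integral_mono_measure (Measure.restrict_mono (Set.iUnion_subset 𝒯.subset) le_rfl)
    (.of_forall fun x => by positivity) hi

theorem sum_h1NormSq_le (𝒯 : Mesh Ω) {u : ScalarL2 Ω} (hu : u ∈ H1 Ω) :
    ∑ i, h1NormSq (𝒯.elem i) (restrictL2 (𝒯.subset i) u) ≤ h1NormSq Ω u := by
  have h := isWeakGrad_weakGrad hu
  simp only [h1NormSq, fun i => weakGrad_eq (h.restrictL2 (𝒯.subset i)), Finset.sum_add_distrib]
  exact add_le_add (sum_norm_restrictL2_sq_le 𝒯 u) (sum_norm_restrictL2_sq_le 𝒯 _)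

theorem sum_hdivNormSq_le (𝒯 : Mesh Ω) {v : VectorL2 Ω} (hv : v ∈ Hdiv Ω) :
    ∑ i, hdivNormSq (𝒯.elem i) (restrictL2 (𝒯.subset i) v) ≤ hdivNormSq Ω v := by
  have h := isWeakDiv_weakDiv hv
  simp only [hdivNormSq, fun i => weakDiv_eq (h.restrictL2 (𝒯.subset i)), Finset.sum_add_distrib]
  exact add_le_add (sum_norm_restrictL2_sq_le 𝒯 v) (sum_norm_restrictL2_sq_le 𝒯 _)

/-- The norm on the mesh is at most the norm on the whole domain. -/
theorem brokenNormSq_le (𝒯 : Mesh Ω) {v : Quad Ω} (hv : v ∈ V0 Ω) :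
    brokenNormSq 𝒯 v ≤
      hdivNormSq Ω v.v₁ + h1NormSq Ω v.v₂ + hdivNormSq Ω v.v₃ + h1NormSq Ω v.v₄ := by
  simp only [brokenNormSq, Finset.sum_add_distrib]
  exact add_le_add (add_le_add (add_le_add (sum_hdivNormSq_le 𝒯 hv.1.1)
    (sum_h1NormSq_le 𝒯 hv.2.1.1)) (sum_hdivNormSq_le 𝒯 hv.2.2.1)) (sum_h1NormSq_le 𝒯 hv.2.2.2)

/-! ### The concrete mixed problem and its equivalence with the system. -/

/-- The map `(u, ∇u) ↦ u` on a space of such pairs. -/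
def valueL (S : Submodule ℝ (WithLp 2 (ScalarL2 Ω × VectorL2 Ω))) : S →L[ℝ] ScalarL2 Ω :=
  (WithLp.fstL 2 ℝ (ScalarL2 Ω) (VectorL2 Ω)).comp S.subtypeL

/-- The map `(u, ∇u) ↦ ∇u` on a space of such pairs. -/
def gradL (S : Submodule ℝ (WithLp 2 (ScalarL2 Ω × VectorL2 Ω))) : S →L[ℝ] VectorL2 Ω :=
  (WithLp.sndL 2 ℝ (ScalarL2 Ω) (VectorL2 Ω)).comp S.subtypeL

variable (S : Submodule ℝ (WithLp 2 (ScalarL2 Ω × VectorL2 Ω)))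

theorem norm_sq_eq_add (p : S) : ‖p‖ ^ 2 = ‖valueL S p‖ ^ 2 + ‖gradL S p‖ ^ 2 :=
  WithLp.prod_norm_sq_eq_of_L2 p.1

theorem norm_valueL_le (p : S) : ‖valueL S p‖ ≤ ‖p‖ := by
  rw [← sq_le_sq₀ (norm_nonneg _) (norm_nonneg _), norm_sq_eq_add]
  linarith [sq_nonneg ‖gradL S p‖]

theorem norm_gradL_le (p : S) : ‖gradL S p‖ ≤ ‖p‖ := by
  rw [← sq_le_sq₀ (norm_nonneg _) (norm_nonneg _), norm_sq_eq_add]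
  linarith [sq_nonneg ‖valueL S p‖]

theorem norm_le_valueL_add_gradL (p : S) : ‖p‖ ≤ ‖valueL S p‖ + ‖gradL S p‖ := by
  rw [← sq_le_sq₀ (norm_nonneg _) (by positivity), norm_sq_eq_add]
  nlinarith [norm_nonneg (valueL S p), norm_nonneg (gradL S p)]

theorem exists_norm_le_gradL (hd : 0 < d) (hb : Bornology.IsBounded (Ω : Set (Space d))) :
    ∃ c : ℝ, 0 < c ∧ ∀ p : h10Graph Ω, ‖p‖ ≤ c * ‖gradL _ p‖ := by
  obtain ⟨C, hC, h⟩ := exists_norm_testL2_le hd hb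
  refine ⟨C + 1, by positivity, fun p => ?_⟩
  have h1 := forall_mem_closure_testPairs (P := fun p => ‖p.1‖ ≤ C * ‖p.2‖)
    (isClosed_le (by fun_prop) (by fun_prop)) h _ p.2
  have h2 := norm_le_valueL_add_gradL _ p
  have h3 : ‖valueL _ p‖ ≤ C * ‖gradL _ p‖ := h1
  linarith

/-- Test functions are among the `w`, so the key estimate applies; `C + 1` accounts for the gradient
part of the graph norm. -/
theorem IsLipschitzDomain.exists_norm_h1Graph_le (hΩ : IsLipschitzDomain Ω) :
    ∃ C : ℝ, 0 < C ∧ ∀ (q : h1Graph Ω) (M : ℝ), 0 ≤ M →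
      (∀ w : h10Graph Ω, |inner ℝ (valueL _ q) (valueL _ w)| ≤ M * ‖gradL _ w‖) →
      ‖q‖ ≤ C * (‖gradL _ q‖ + M) := by
  obtain ⟨C, hC, h⟩ := hΩ.exists_norm_le
  refine ⟨C + 1, by positivity, fun q M hM hq => ?_⟩
  have h1 : ‖valueL _ q‖ ≤ C * (‖gradL _ q‖ + M) := by
    refine h _ _ M hM q.2 fun φ => ?_
    have := hq ⟨WithLp.toLp 2 (testL2 φ, gradL2 φ),
      mem_h10Graph.2 (subset_closure (mem_testPairs_iff.2 ⟨φ, rfl⟩))⟩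
    rw [real_inner_comm]
    exact this
  have h2 := norm_le_valueL_add_gradL _ q
  linarith

/-- The mixed variational problem equivalent to the adjoint first-order system. -/
abbrev SolvesMixed (g₁ : VectorL2 Ω) (g₂ : ScalarL2 Ω) (g₃ : VectorL2 Ω) (g₄ : ScalarL2 Ω)
    (p : h10Graph Ω) (q : h1Graph Ω) : Prop :=
  SolvesWeak (valueL (h10Graph Ω)) (gradL (h10Graph Ω)) (valueL (h1Graph Ω)) (gradL (h1Graph Ω))
    g₁ g₂ g₃ g₄ p q

/-- The solution of the first-order system recovered from that of the mixed problem. -/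
def quadOfMixed (g₁ g₃ : VectorL2 Ω) (p : h10Graph Ω) (q : h1Graph Ω) : Quad Ω where
  v₁ := g₁ + gradL _ q
  v₂ := valueL _ p
  v₃ := g₃ - gradL _ p
  v₄ := valueL _ q

variable {g₁ g₃ : VectorL2 Ω} {g₂ g₄ : ScalarL2 Ω}

theorem SolvesMixed.mem_V0_and_solvesAdjoint {p : h10Graph Ω} {q : h1Graph Ω}
    (h : SolvesMixed g₁ g₂ g₃ g₄ p q) :
    quadOfMixed g₁ g₃ p q ∈ V0 Ω ∧ SolvesAdjoint g₁ g₂ g₃ g₄ (quadOfMixed g₁ g₃ p q) := by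
  have hp : IsWeakGrad Ω (valueL _ p) (gradL _ p) := isWeakGrad_of_mem_closure p.2
  have hq : IsWeakGrad Ω (valueL _ q) (gradL _ q) := q.2
  have h3 : IsWeakDiv Ω (g₃ - gradL _ p) (g₂ - valueL _ q) := by
    rw [isWeakDiv_iff_closure]
    intro w hw
    have := h.1 ⟨WithLp.toLp 2 w, hw⟩
    change inner ℝ (valueL _ q) w.1 + inner ℝ (gradL _ p) w.2 =
      inner ℝ g₂ w.1 + inner ℝ g₃ w.2 at this
    rw [real_inner_comm, inner_sub_left, real_inner_comm (g₃ - _), inner_sub_left]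
    linarith
  -- Being valid for all `z ∈ H¹`, this gives both the weak divergence of `v₁`, on test functions,
  -- and its vanishing normal trace.
  have hB : ∀ z G, IsWeakGrad Ω z G →
      inner ℝ z (g₄ - valueL _ p) + inner ℝ G (g₁ + gradL _ q) = 0 := by
    intro z G hz
    have := h.2 ⟨WithLp.toLp 2 (z, G), hz⟩
    change inner ℝ (gradL _ q) G - inner ℝ (valueL _ p) z = -inner ℝ g₄ z - inner ℝ g₁ G at this
    rw [real_inner_comm, inner_sub_left, real_inner_comm (g₁ + _), inner_add_left]
    linarith
  have h1 : IsWeakDiv Ω (g₁ + gradL _ q) (g₄ - valueL _ p) := by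
    rw [isWeakDiv_iff]
    exact fun φ => hB _ _ (isWeakGrad_test φ)
  refine ⟨⟨⟨⟨_, h1⟩, fun z hz => ?_⟩, mem_H10_of_mem_closure p.2, ⟨_, h3⟩, ⟨_, hq⟩⟩,
    ?_, ?_, ?_, ?_⟩
  · simp only [quadOfMixed]
    rw [weakDiv_eq h1]
    exact hB z _ (isWeakGrad_weakGrad hz)
  · simp only [quadOfMixed]
    rw [weakGrad_eq hq, add_sub_cancel_right]
  · simp only [quadOfMixed]
    rw [weakDiv_eq h3, add_sub_cancel]
  · simp only [quadOfMixed]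
    rw [weakGrad_eq hp, sub_add_cancel]
  · simp only [quadOfMixed]
    rw [weakDiv_eq h1, add_sub_cancel]

/-- The converse reduction carries uniqueness and the bound from the mixed problem to the system.
The divergence of `v₃` may be tested on all of `H¹₀` by density, that of `v₁` on `H¹` by the zero
normal trace. -/
theorem SolvesAdjoint.exists_solvesMixed {v : Quad Ω} (hv : v ∈ V0 Ω)
    (h : SolvesAdjoint g₁ g₂ g₃ g₄ v) :
    ∃ p q, SolvesMixed g₁ g₂ g₃ g₄ p q ∧ v = quadOfMixed g₁ g₃ p q ∧
      weakGrad Ω v.v₂ = gradL _ p ∧ weakGrad Ω v.v₄ = gradL _ q := by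
  obtain ⟨h1, h2, h3, h4⟩ := h
  obtain ⟨⟨hv1, hv1'⟩, ⟨hv2, hv2'⟩, hv3, hv4⟩ := hv
  have e1 : v.v₁ = g₁ + weakGrad Ω v.v₄ := by rw [← h1, sub_add_cancel]
  have e3 : v.v₃ = g₃ - weakGrad Ω v.v₂ := by rw [← h3, add_sub_cancel_right]
  have d3 : weakDiv Ω v.v₃ = g₂ - v.v₄ := by rw [← h2, add_sub_cancel_left]
  have d1 : weakDiv Ω v.v₁ = g₄ - v.v₂ := by rw [← h4, add_sub_cancel_left]
  refine ⟨⟨WithLp.toLp 2 (v.v₂, weakGrad Ω v.v₂), hv2'⟩,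
    ⟨WithLp.toLp 2 (v.v₄, weakGrad Ω v.v₄), isWeakGrad_weakGrad hv4⟩, ⟨fun w => ?_, fun z => ?_⟩,
    Quad.ext e1 rfl e3 rfl, rfl, rfl⟩
  · have h5 := isWeakDiv_iff_closure.1 (isWeakDiv_weakDiv hv3) _ w.2
    change inner ℝ (valueL _ w) _ + inner ℝ (gradL _ w) _ = 0 at h5
    rw [d3, e3, real_inner_comm, inner_sub_left, real_inner_comm (g₃ - _), inner_sub_left] at h5
    change inner ℝ v.v₄ _ + inner ℝ (weakGrad Ω v.v₂) _ = _
    linarith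
  · have hz : IsWeakGrad Ω (valueL _ z) (gradL _ z) := z.2
    have h5 := hv1' (valueL _ z) ⟨_, hz⟩
    rw [weakGrad_eq hz, d1, e1, real_inner_comm, inner_sub_left, real_inner_comm (g₁ + _),
      inner_add_left] at h5
    change inner ℝ (weakGrad Ω v.v₄) _ - inner ℝ v.v₂ _ = _
    linarith

theorem IsLipschitzDomain.exists_norm_le_of_solvesMixed (hd : 0 < d) (hΩ : IsLipschitzDomain Ω) :
    ∃ A : ℝ, 0 ≤ A ∧ ∀ g₁ g₂ g₃ g₄ (p : h10Graph Ω) (q : h1Graph Ω),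
      SolvesMixed g₁ g₂ g₃ g₄ p q →
        ‖p‖ ≤ A * (‖g₁‖ + ‖g₂‖ + ‖g₃‖ + ‖g₄‖) ∧ ‖q‖ ≤ A * (‖g₁‖ + ‖g₂‖ + ‖g₃‖ + ‖g₄‖) := by
  obtain ⟨c, hc, hX⟩ := exists_norm_le_gradL hd hΩ.bounded
  obtain ⟨C, hC, hY⟩ := hΩ.exists_norm_h1Graph_le
  exact SolvesWeak.exists_norm_le (norm_valueL_le _) (norm_gradL_le _) (norm_valueL_le _)
    (norm_gradL_le _) hc hX hC hY

theorem IsLipschitzDomain.exists_solvesMixed (hd : 0 < d) (hΩ : IsLipschitzDomain Ω)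
    (g₁ : VectorL2 Ω) (g₂ : ScalarL2 Ω) (g₃ : VectorL2 Ω) (g₄ : ScalarL2 Ω) :
    ∃ p q, SolvesMixed g₁ g₂ g₃ g₄ p q := by
  obtain ⟨c, hc, hX⟩ := exists_norm_le_gradL hd hΩ.bounded
  obtain ⟨C, hC, hY⟩ := hΩ.exists_norm_h1Graph_le
  have : CompleteSpace (h10Graph Ω) := isClosed_h10Graph.completeSpace_coe
  have : CompleteSpace (h1Graph Ω) := isClosed_h1Graph.completeSpace_coe
  exact exists_solvesWeak hc hX hC hY g₁ g₂ g₃ g₄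

theorem SolvesWeak.sub {X Y H K : Type*}
    [NormedAddCommGroup X] [InnerProductSpace ℝ X] [NormedAddCommGroup Y] [InnerProductSpace ℝ Y]
    [NormedAddCommGroup H] [InnerProductSpace ℝ H] [NormedAddCommGroup K] [InnerProductSpace ℝ K]
    {ι₀ : X →L[ℝ] H} {D₀ : X →L[ℝ] K} {ι₁ : Y →L[ℝ] H} {D₁ : Y →L[ℝ] K}
    {g₁ : K} {g₂ : H} {g₃ : K} {g₄ : H} {p p' : X} {q q' : Y}
    (h : SolvesWeak ι₀ D₀ ι₁ D₁ g₁ g₂ g₃ g₄ p q) (h' : SolvesWeak ι₀ D₀ ι₁ D₁ g₁ g₂ g₃ g₄ p' q') :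
    SolvesWeak ι₀ D₀ ι₁ D₁ 0 0 0 0 (p - p') (q - q') := by
  refine ⟨fun w => ?_, fun z => ?_⟩
  · rw [map_sub, map_sub, inner_sub_left, inner_sub_left, inner_zero_left, inner_zero_left]
    linarith [h.1 w, h'.1 w]
  · rw [map_sub, map_sub, inner_sub_left, inner_sub_left, inner_zero_left, inner_zero_left]
    linarith [h.2 z, h'.2 z]

end FourthOrderDiv

end

open FourthOrderDiv

/-! ### The main theorem. -/

theorem mainTheorem11 (d : ℕ) (hd : 2 ≤ d) (Ω : TopologicalSpace.Opens (FourthOrderDiv.Space d))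
    (hΩ : FourthOrderDiv.IsLipschitzDomain Ω)
    (hsc : IsSimplyConnected (Ω : Set (FourthOrderDiv.Space d))) :
    ∃ C : ℝ, 0 < C ∧
      ∀ (g₁ : FourthOrderDiv.VectorL2 Ω) (g₂ : FourthOrderDiv.ScalarL2 Ω)
        (g₃ : FourthOrderDiv.VectorL2 Ω) (g₄ : FourthOrderDiv.ScalarL2 Ω),
        (∃! v : FourthOrderDiv.Quad Ω,
          v ∈ FourthOrderDiv.V0 Ω ∧ FourthOrderDiv.SolvesAdjoint g₁ g₂ g₃ g₄ v) ∧
        ∀ v ∈ FourthOrderDiv.V0 Ω, FourthOrderDiv.SolvesAdjoint g₁ g₂ g₃ g₄ v →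
          ∀ 𝒯 : FourthOrderDiv.Mesh Ω,
            FourthOrderDiv.brokenNormSq 𝒯 v ≤
              C * (‖g₁‖ ^ 2 + ‖g₂‖ ^ 2 + ‖g₃‖ ^ 2 + ‖g₄‖ ^ 2) := by
  have hd0 : 0 < d := by omega
  obtain ⟨A, hA, hAle⟩ := hΩ.exists_norm_le_of_solvesMixed hd0
  -- Each of the eight norms is at most `(A + 1) γ`, the `+ 1` absorbing the datum in each equation;
  -- `4` comes from `γ² ≤ 4 ∑ ‖gᵢ‖²`.
  refine ⟨4 * (8 * (A + 1) ^ 2), by positivity, fun g₁ g₂ g₃ g₄ => ⟨?_, fun v hv hsol 𝒯 => ?_⟩⟩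
  · obtain ⟨p, q, hpq⟩ := hΩ.exists_solvesMixed hd0 g₁ g₂ g₃ g₄
    refine ⟨quadOfMixed g₁ g₃ p q, hpq.mem_V0_and_solvesAdjoint, fun v ⟨hv, hsol⟩ => ?_⟩
    obtain ⟨p', q', hpq', rfl, -, -⟩ := hsol.exists_solvesMixed hv
    -- The difference of two solutions has zero data, so the a priori bound makes it vanish.
    have h := hAle _ _ _ _ _ _ (hpq'.sub hpq)
    simp only [norm_zero, add_zero, mul_zero, norm_le_zero_iff, sub_eq_zero] at h
    rw [h.1, h.2]
  · obtain ⟨p, q, hpq, hvpq, hg2, hg4⟩ := hsol.exists_solvesMixed hv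
    obtain ⟨hp, hq⟩ := hAle _ _ _ _ _ _ hpq
    refine (brokenNormSq_le 𝒯 hv).trans ?_
    obtain ⟨h1, h2, h3, h4⟩ := hsol
    set γ : ℝ := ‖g₁‖ + ‖g₂‖ + ‖g₃‖ + ‖g₄‖ with hγ
    have n1 := norm_nonneg g₁
    have n2 := norm_nonneg g₂
    have n3 := norm_nonneg g₃
    have n4 := norm_nonneg g₄
    have hγ0 : 0 ≤ γ := by positivity
    have b2 : ‖v.v₂‖ ≤ A * γ := by
      rw [hvpq]
      exact (norm_valueL_le _ p).trans hp
    have b4 : ‖v.v₄‖ ≤ A * γ := by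
      rw [hvpq]
      exact (norm_valueL_le _ q).trans hq
    have c2 : ‖weakGrad Ω v.v₂‖ ≤ A * γ := by
      rw [hg2]
      exact (norm_gradL_le _ p).trans hp
    have c4 : ‖weakGrad Ω v.v₄‖ ≤ A * γ := by
      rw [hg4]
      exact (norm_gradL_le _ q).trans hq
    have b1 : ‖v.v₁‖ ≤ (A + 1) * γ := by
      rw [← sub_add_cancel v.v₁ (weakGrad Ω v.v₄), h1]
      linarith [norm_add_le g₁ (weakGrad Ω v.v₄)]
    have b3 : ‖v.v₃‖ ≤ (A + 1) * γ := by
      rw [← add_sub_cancel_right v.v₃ (weakGrad Ω v.v₂), h3]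
      linarith [norm_sub_le g₃ (weakGrad Ω v.v₂)]
    have c1 : ‖weakDiv Ω v.v₁‖ ≤ (A + 1) * γ := by
      rw [← add_sub_cancel_left v.v₂ (weakDiv Ω v.v₁), h4]
      linarith [norm_sub_le g₄ v.v₂]
    have c3 : ‖weakDiv Ω v.v₃‖ ≤ (A + 1) * γ := by
      rw [← add_sub_cancel_left v.v₄ (weakDiv Ω v.v₃), h2]
      linarith [norm_sub_le g₂ v.v₄]
    have hsq : ∀ t : ℝ, 0 ≤ t → t ≤ (A + 1) * γ → t ^ 2 ≤ (A + 1) ^ 2 * γ ^ 2 := by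
      intro t ht h
      rw [← mul_pow]
      exact pow_le_pow_left₀ ht h 2
    have hγ2 : γ ^ 2 ≤ 4 * (‖g₁‖ ^ 2 + ‖g₂‖ ^ 2 + ‖g₃‖ ^ 2 + ‖g₄‖ ^ 2) := by
      rw [hγ]
      nlinarith [sq_nonneg (‖g₁‖ - ‖g₂‖), sq_nonneg (‖g₁‖ - ‖g₃‖), sq_nonneg (‖g₁‖ - ‖g₄‖),
        sq_nonneg (‖g₂‖ - ‖g₃‖), sq_nonneg (‖g₂‖ - ‖g₄‖), sq_nonneg (‖g₃‖ - ‖g₄‖)]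
    have hfin := mul_le_mul_of_nonneg_left hγ2 (by positivity : 0 ≤ 8 * (A + 1) ^ 2)
    simp only [hdivNormSq, h1NormSq]
    linarith [hsq _ (norm_nonneg _) b1, hsq _ (norm_nonneg _) c1, hsq _ (norm_nonneg _) b3,
      hsq _ (norm_nonneg _) c3, hsq ‖v.v₂‖ (norm_nonneg _) (by linarith),
      hsq ‖v.v₄‖ (norm_nonneg _) (by linarith),
      hsq ‖weakGrad Ω v.v₂‖ (norm_nonneg _) (by linarith),
      hsq ‖weakGrad Ω v.v₄‖ (norm_nonneg _) (by linarith)]
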